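/- Let $H_1, H_2$ be complex Hilbert spaces; inner products are linear in the first and antilinear in the second argument. Let $A_1 : \operatorname{dom}(A_1) \subseteq H_1 \times H_2 \to H_1$ and $A_{21} : \operatorname{dom}(A_{21}) \subseteq H_1 \to H_2$ be linear operators, and let $S : H_2 \to H_2$ be bounded, linear and coercive, i.e. there is $\nu > 0$ with $\operatorname{Re}\langle h, S h\rangle \ge \nu \|h\|^2$ for all $h \in H_2$. Define the operator $A_{\mathrm{ext}}$ on $H_1 \times H_2$ by $$\operatorname{dom}(A_{\mathrm{ext}}) = \{(h_1,h_2) \in \operatorname{dom}(A_1) : h_1 \in \operatorname{dom}(A_{21})\}, \qquad A_{\mathrm{ext}}(h_1,h_2) = (A_1(h_1,h_2),\, A_{21}h_1),$$ and the operator $A_S$ on $H_1$ by $$\operatorname{dom}(A_S) = \{h_1 \in \operatorname{dom}(A_{21}) : (h_1, S A_{21} h_1) \in \operatorname{dom}(A_1)\}, \qquad A_S h_1 = A_1(h_1, S A_{21}h_1).$$ Assume that $A_1$ splits: $\operatorname{dom}(A_1) = \operatorname{dom}(A_{11}) \times \operatorname{dom}(A_{12})$ and $A_1(h_1,h_2)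 = A_{11}h_1 + A_{12}h_2$ for linear operators $A_{11}: \operatorname{dom}(A_{11}) \subseteq H_1 \to H_1$ and $A_{12} : \operatorname{dom}(A_{12}) \subseteq H_2 \to H_1$, where $A_{11}$ is everywhere defined and bounded. Assume moreover that $A_{\mathrm{ext}}$ generates a contractive $C_0$-semigroup on $H_1 \times H_2$. Endow $\operatorname{dom}(A_{21})$ with the graph norm $\|u\|_{A_{21}}^2 = \|A_{21}u\|^2 + \|u\|^2$ and let $$a(u,v) = \langle S A_{21} u, A_{21} v\rangle_{H_2} - \langle A_{11} u, v\rangle_{H_1}, \qquad u,v \in \operatorname{dom}(A_{21}).$$ Then: (1) $(a, \operatorname{dom}(A_{21}))$ is a closed elliptic form on $H_1$, that is: $V = \operatorname{dom}(A_{21})$ with the graph norm is a Hilbert space that is densely and continuously embedded in $H_1$; $a$ is sesquilinear and there is $M \ge 0$ with $|a(u,v)| \le M\|u\|_V\|v\|_V$ for all $u,v \in V$; and there are $\alpha > 0$ and $\omega \in \mathbb{R}$ with $\operatorname{Re} a(u,u) + \omega\|u\|_{H_1}^2 \ge \alpha \|u\|_V^2$ for all $u \in V$. (2) The operator on $H_1$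 associated to this form is $-A_S$. Here the associated operator $A$ is given as follows: $u \in \operatorname{dom}(A)$ and $Au = f$ if and only if $u \in V$, $f \in H_1$ and $a(u,v) = \langle f, v\rangle_{H_1}$ for all $v \in V$. (3) $A_S$ generates a $C_0$-semigroup $(e^{tA_S})_{t \ge 0}$ on $H_1$, and this semigroup is analytic: for some $\theta \in (0,\pi/2]$ it extends to a holomorphic operator-valued map on the sector $\{z \ne 0 : |\arg z| < \theta\}$ that satisfies the semigroup law there and converges strongly to the identity as $z \to 0$ in every strictly smaller sector $\{z \ne 0 : |\arg z| < \theta'\}$, $0 < \theta' < \theta$. -/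

import Mathlib

open Filter Topology
open scoped NNReal ComplexConjugate InnerProductSpace

noncomputable section

/-! ### Strongly continuous semigroups, generators, analyticity -/

/-- A `C₀`-semigroup of bounded linear operators on a complex normed space. -/
structure C0Semigroup (X : Type*) [NormedAddCommGroup X] [NormedSpace ℂ X] where
  toFun : ℝ≥0 → X →L[ℂ] X
  map_zero : toFun 0 = ContinuousLinearMap.id ℂ X
  map_add : ∀ s t, toFun (s + t) = (toFun s).comp (toFun t)
  continuous_orbit : ∀ x, Continuous fun t => toFun t x

namespace C0Semigroup

variable {X : Type*} [NormedAddCommGroup X] [NormedSpace ℂ X]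

/-- `A` is the generator of `T`: one has `x ∈ dom A` and `A x = y` if and only if the
difference quotients `(T t x - x) / t` converge to `y` as `t ↓ 0`. -/
def HasGenerator (T : C0Semigroup X) (A : X →ₗ.[ℂ] X) : Prop :=
  ∀ x y : X, (x, y) ∈ A.graph ↔
    Tendsto (fun t : ℝ≥0 => (((t : ℝ) : ℂ)⁻¹) • (T.toFun t x - x)) (𝓝[>] 0) (𝓝 y)

/-- The semigroup consists of contractions. -/
def IsContractive (T : C0Semigroup X) : Prop :=
  ∀ t, ‖T.toFun t‖ ≤ 1

/-- The open sector `{z ≠ 0 : |arg z| < θ}`. -/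
def sector (θ : ℝ) : Set ℂ := {z | z ≠ 0 ∧ |z.arg| < θ}

/-- The semigroup is analytic: for some `θ ∈ (0, π/2]` it extends to a holomorphic
operator-valued map on the sector of angle `θ` which satisfies the semigroup law there and is
strongly continuous at `0` on every strictly smaller sector. -/
def IsAnalytic (T : C0Semigroup X) : Prop :=
  ∃ θ : ℝ, 0 < θ ∧ θ ≤ Real.pi / 2 ∧ ∃ U : ℂ → X →L[ℂ] X,
    (∀ t : ℝ≥0, 0 < t → U ((t : ℝ) : ℂ) = T.toFun t) ∧
    DifferentiableOn ℂ U (sector θ) ∧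
    (∀ z ∈ sector θ, ∀ w ∈ sector θ, U (z + w) = (U z).comp (U w)) ∧
    (∀ θ' : ℝ, 0 < θ' → θ' < θ → ∀ x : X,
      Tendsto (fun z => U z x) (𝓝[sector θ'] 0) (𝓝 x))

end C0Semigroup

/-- `A` generates a contractive `C₀`-semigroup. -/
def GeneratesContractionSemigroup {X : Type*} [NormedAddCommGroup X] [NormedSpace ℂ X]
    (A : X →ₗ.[ℂ] X) : Prop :=
  ∃ T : C0Semigroup X, T.HasGenerator A ∧ T.IsContractive

/-! ### Closed forms and their operators

Mathlib's `⟪x, y⟫_ℂ` is antilinear in `x` and linear in `y`. So an inner product that is written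
`⟨f, v⟩` in the convention "linear in the first argument" is `⟪v, f⟫_ℂ` here. -/

section Forms

variable {H V : Type*} [NormedAddCommGroup H] [InnerProductSpace ℂ H]
  [NormedAddCommGroup V] [InnerProductSpace ℂ V]

/-- `(a, V)` is a closed (elliptic) form on `H`: `V` is a Hilbert space that is, through the
inclusion map `ι`, a densely and continuously embedded vector subspace of `H`; and the
sesquilinear map `a` (linear in the first, antilinear in the second argument) is continuous on `V`
and elliptic. -/
structure IsClosedForm (ι : V →ₗ[ℂ] H) (a : V →ₗ[ℂ] V →ₗ⋆[ℂ] ℂ) : Prop where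
  complete : CompleteSpace V
  injective : Function.Injective ι
  dense : DenseRange ι
  continuous_incl : Continuous ι
  bounded : ∃ M : ℝ, 0 ≤ M ∧ ∀ u v, ‖a u v‖ ≤ M * ‖u‖ * ‖v‖
  elliptic : ∃ α : ℝ, 0 < α ∧ ∃ ω : ℝ, ∀ u, α * ‖u‖ ^ 2 ≤ (a u u).re + ω * ‖ι u‖ ^ 2

/-- `A` is the operator on `H` associated to the form `(a, V)`: one has `x ∈ dom A` and `A x = f`
if and only if `x = u` for some `u ∈ V` such that `a(u, v) = ⟨f, v⟩` for all `v ∈ V`. -/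
def IsAssociatedOperator (ι : V →ₗ[ℂ] H) (a : V →ₗ[ℂ] V →ₗ⋆[ℂ] ℂ) (A : H →ₗ.[ℂ] H) : Prop :=
  ∀ x f : H, (x, f) ∈ A.graph ↔ ∃ u : V, ι u = x ∧ ∀ v : V, a u v = ⟪ι v, f⟫_ℂ

end Forms

/-! ### The domain of an operator with its graph norm -/

section GraphDomain

variable {H K : Type*} [NormedAddCommGroup H] [InnerProductSpace ℂ H]
  [NormedAddCommGroup K] [InnerProductSpace ℂ K]

/-- The vector space `dom A`, to be endowed with the graph norm of `A` instead of the norm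
of the ambient space. -/
def GraphDomain (A : H →ₗ.[ℂ] K) : Type _ := A.domain

namespace GraphDomain

variable (A : H →ₗ.[ℂ] K)

instance instAddCommGroup : AddCommGroup (GraphDomain A) := inferInstanceAs (AddCommGroup A.domain)

instance instModule : Module ℂ (GraphDomain A) := inferInstanceAs (Module ℂ A.domain)

/-- The inclusion of `dom A` into the ambient space. -/
def incl : GraphDomain A →ₗ[ℂ] H := A.domain.subtype

/-- The operator `A` as a map on its domain. -/
def op : GraphDomain A →ₗ[ℂ] K := A.toFun

/-- The inner product `⟨A u, A v⟩ + ⟨u, v⟩` on `dom A`. -/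
@[reducible]
def core : InnerProductSpace.Core ℂ (GraphDomain A) where
  inner u v := ⟪op A u, op A v⟫_ℂ + ⟪incl A u, incl A v⟫_ℂ
  conj_inner_symm u v := by simp only [map_add, inner_conj_symm]
  re_inner_nonneg u := by
    rw [map_add]
    exact add_nonneg inner_self_nonneg inner_self_nonneg
  add_left u v w := by
    simp only [map_add, inner_add_left]
    ring
  smul_left u v c := by
    simp only [map_smul, inner_smul_left]
    ring
  definite u h := by
    have h1 := congrArg RCLike.re h
    rw [map_add, map_zero] at h1
    have h2 : 0 ≤ RCLike.re ⟪op A u, op A u⟫_ℂ := inner_self_nonneg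
    have h3 : 0 ≤ RCLike.re ⟪incl A u, incl A u⟫_ℂ := inner_self_nonneg
    have h4 : incl A u = 0 := by
      rw [← re_inner_self_nonpos (𝕜 := ℂ)]
      linarith
    exact Subtype.ext h4

instance instNormedAddCommGroup : NormedAddCommGroup (GraphDomain A) :=
  (core A).toNormedAddCommGroup

instance instInnerProductSpace : InnerProductSpace ℂ (GraphDomain A) :=
  InnerProductSpace.ofCore (core A).toCore

theorem norm_sq (u : GraphDomain A) : ‖u‖ ^ 2 = ‖op A u‖ ^ 2 + ‖incl A u‖ ^ 2 := by
  have h : ⟪u, u⟫_ℂ = ⟪op A u, op A u⟫_ℂ + ⟪incl A u, incl A u⟫_ℂ := rfl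
  have h' := congrArg RCLike.re h
  rw [map_add] at h'
  simpa only [inner_self_eq_norm_sq] using h'

end GraphDomain

end GraphDomain

/-! ### The operators `A_ext` and `A_S` -/

section Operators

variable {H₁ H₂ : Type*} [NormedAddCommGroup H₁] [InnerProductSpace ℂ H₁]
  [NormedAddCommGroup H₂] [InnerProductSpace ℂ H₂]

/-- `S` is coercive: `Re ⟨h, S h⟩ ≥ ν ‖h‖²` for some `ν > 0`. -/
def IsCoerciveOperator (S : H₂ →L[ℂ] H₂) : Prop :=
  ∃ ν : ℝ, 0 < ν ∧ ∀ h : H₂, ν * ‖h‖ ^ 2 ≤ (⟪h, S h⟫_ℂ).re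

/-- The extended operator: its domain consists of those `(h₁, h₂) ∈ dom A₁` for which
`h₁ ∈ dom A₂₁`, and it maps `(h₁, h₂)` to `(A₁ (h₁, h₂), A₂₁ h₁)`. -/
def opExt (A₁ : WithLp 2 (H₁ × H₂) →ₗ.[ℂ] H₁) (A₂₁ : H₁ →ₗ.[ℂ] H₂) :
    WithLp 2 (H₁ × H₂) →ₗ.[ℂ] WithLp 2 (H₁ × H₂) where
  domain := A₁.domain ⊓ A₂₁.domain.comap (WithLp.fstₗ 2 ℂ H₁ H₂)
  toFun :=
    { toFun := fun h => WithLp.toLp 2 (A₁ ⟨h.1, h.2.1⟩, A₂₁ ⟨h.1.fst, h.2.2⟩)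
      map_add' := fun h k => by
        rw [← WithLp.toLp_add, Prod.mk_add_mk, ← LinearPMap.map_add, ← LinearPMap.map_add]
        rfl
      map_smul' := fun c h => by
        rw [RingHom.id_apply, ← WithLp.toLp_smul, Prod.smul_mk, ← LinearPMap.map_smul,
          ← LinearPMap.map_smul]
        rfl }

/-- The domain of `A_S`: all `h ∈ dom A₂₁` such that `(h, S A₂₁ h) ∈ dom A₁`. -/
def opSDomain (A₁ : WithLp 2 (H₁ × H₂) →ₗ.[ℂ] H₁) (A₂₁ : H₁ →ₗ.[ℂ] H₂) (S : H₂ →L[ℂ] H₂) :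
    Submodule ℂ H₁ where
  carrier := {h | ∃ hh : h ∈ A₂₁.domain, WithLp.toLp 2 (h, S (A₂₁ ⟨h, hh⟩)) ∈ A₁.domain}
  zero_mem' := by
    refine ⟨A₂₁.domain.zero_mem, ?_⟩
    have h0 : A₂₁ ⟨0, A₂₁.domain.zero_mem⟩ = 0 := LinearPMap.map_zero A₂₁
    rw [h0, map_zero]
    exact A₁.domain.zero_mem
  add_mem' := by
    rintro h k ⟨hh, h'⟩ ⟨hk, k'⟩
    refine ⟨A₂₁.domain.add_mem hh hk, ?_⟩
    have h0 : A₂₁ ⟨h + k, A₂₁.domain.add_mem hh hk⟩ = A₂₁ ⟨h, hh⟩ + A₂₁ ⟨k, hk⟩ :=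
      LinearPMap.map_add A₂₁ ⟨h, hh⟩ ⟨k, hk⟩
    rw [h0, map_add]
    exact A₁.domain.add_mem h' k'
  smul_mem' := by
    rintro c h ⟨hh, h'⟩
    refine ⟨A₂₁.domain.smul_mem c hh, ?_⟩
    have h0 : A₂₁ ⟨c • h, A₂₁.domain.smul_mem c hh⟩ = c • A₂₁ ⟨h, hh⟩ :=
      LinearPMap.map_smul A₂₁ c ⟨h, hh⟩
    rw [h0, map_smul]
    exact A₁.domain.smul_mem c h'

/-- The operator `A_S`, given by `A_S h = A₁ (h, S A₂₁ h)`. -/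
def opS (A₁ : WithLp 2 (H₁ × H₂) →ₗ.[ℂ] H₁) (A₂₁ : H₁ →ₗ.[ℂ] H₂) (S : H₂ →L[ℂ] H₂) :
    H₁ →ₗ.[ℂ] H₁ where
  domain := opSDomain A₁ A₂₁ S
  toFun :=
    { toFun := fun h => A₁ ⟨WithLp.toLp 2 (h.1, S (A₂₁ ⟨h.1, h.2.1⟩)), h.2.2⟩
      map_add' := fun h k => by
        rw [← LinearPMap.map_add]
        congr 1
        apply Subtype.ext
        have h0 : A₂₁ ⟨(h + k).1, (h + k).2.1⟩ = A₂₁ ⟨h.1, h.2.1⟩ + A₂₁ ⟨k.1, k.2.1⟩ :=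
          LinearPMap.map_add A₂₁ ⟨h.1, h.2.1⟩ ⟨k.1, k.2.1⟩
        simp only [h0, map_add]
        rfl
      map_smul' := fun c h => by
        rw [RingHom.id_apply, ← LinearPMap.map_smul]
        congr 1
        apply Subtype.ext
        have h0 : A₂₁ ⟨(c • h).1, (c • h).2.1⟩ = c • A₂₁ ⟨h.1, h.2.1⟩ :=
          LinearPMap.map_smul A₂₁ c ⟨h.1, h.2.1⟩
        simp only [h0, map_smul]
        rfl }

/-- `A₁` splits as `(A₁₁  A₁₂)`: one has `dom A₁ = dom A₁₁ × dom A₁₂` and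
`A₁ (h₁, h₂) = A₁₁ h₁ + A₁₂ h₂`. -/
def SplitsAs (A₁ : WithLp 2 (H₁ × H₂) →ₗ.[ℂ] H₁) (A₁₁ : H₁ →ₗ.[ℂ] H₁) (A₁₂ : H₂ →ₗ.[ℂ] H₁) :
    Prop :=
  (∀ h, h ∈ A₁.domain ↔ h.fst ∈ A₁₁.domain ∧ h.snd ∈ A₁₂.domain) ∧
  ∀ (h : A₁.domain) (h₁ : A₁₁.domain) (h₂ : A₁₂.domain),
    (h : WithLp 2 (H₁ × H₂)) = WithLp.toLp 2 ((h₁ : H₁), (h₂ : H₂)) → A₁ h = A₁₁ h₁ + A₁₂ h₂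

/-- The sesquilinear map `a(u, v) = ⟨S A₂₁ u, A₂₁ v⟩ - ⟨A₁₁ u, v⟩` on `dom A₂₁`. -/
def formOf (A₁₁ : H₁ →L[ℂ] H₁) (A₂₁ : H₁ →ₗ.[ℂ] H₂) (S : H₂ →L[ℂ] H₂) :
    GraphDomain A₂₁ →ₗ[ℂ] GraphDomain A₂₁ →ₗ⋆[ℂ] ℂ :=
  LinearMap.mk₂'ₛₗ (RingHom.id ℂ) (starRingEnd ℂ)
    (fun u v => ⟪GraphDomain.op A₂₁ v, S (GraphDomain.op A₂₁ u)⟫_ℂ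
      - ⟪GraphDomain.incl A₂₁ v, A₁₁ (GraphDomain.incl A₂₁ u)⟫_ℂ)
    (fun u u' v => by simp only [map_add, inner_add_right]; ring)
    (fun c u v => by
      simp only [map_smul, inner_smul_right, RingHom.id_apply, smul_eq_mul]; ring)
    (fun u v v' => by simp only [map_add, inner_add_left]; ring)
    (fun c u v => by simp only [map_smul, inner_smul_left, smul_eq_mul]; ring)

end Operators

end

/-!
The contraction semigroup generated by `A_ext` enters only through two facts: `A_ext` is
dissipative, and `1 - A_ext` is surjective. The latter holds because the truncated Laplace transform
`y = ∫₀¹ e⁻ᵗ T(t) x dt` satisfies `(1 - A_ext) y = x - e⁻¹ T(1) x`, and `1 - e⁻¹ T(1)` is inverted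
by a Neumann series (`C0Semigroup.HasGenerator.exists_sub_eq`). It follows that `A_ext` is closed
and densely defined, and these properties pass to `A₂₁`, whose domain is therefore a Hilbert space
for the graph norm, dense in `H₁`. The boundedness and ellipticity of the form are then immediate
from the boundedness of `A₁₁` and `S` and the coercivity of `S`.

The operator associated to the form is `-A_S` because `-A₁₂` is the adjoint of `A₂₁`. Dissipativity
of `A_ext` bounds `Re (c ⟨A₁₂ w, u⟩ + c̄ ⟨A₂₁ u, w⟩)` from above for all complex `c`, which
gives `-A₁₂ ⊆ A₂₁*` (`SplitsAs.inner_eq_neg_inner`); surjectivity of `1 - A_ext` gives the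
reverse inclusion (`SplitsAs.mem_graph_neg_of_inner_eq`).

Finally, let `-A` be associated to any closed form. The numerical range of `A` lies in a sector with
vertex `ω` around the half line `(-∞, ω]`, and `l - A` is surjective for `l > ω` by the Lax–Milgram
lemma; after a shift, `ω = 0`. The Yosida approximations `A_n` of `A` have their numerical ranges in
the same sector, so that `exp (z A_n)` is a contraction for every `z` in the complementary sector
around the positive real axis (`norm_exp_le_one`). As the `A_n` commute,
`‖exp (z A_n) x - exp (z A_m) x‖ ≤ |z| ‖A_n x - A_m x‖`, and `A_n x → A x` for `x ∈ dom A`; hence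
`exp (z A_n)` converges strongly, locally uniformly in `z`, to contractions `U z`
(`exists_tendstoUniformlyOn_exp`). The semigroup law, strong continuity up to the boundary of the
sector and strong holomorphy in its interior pass to the limit, and strong holomorphy improves to
holomorphy in operator norm by Cauchy's integral formula (`differentiableOn_of_apply`). No contour
integral representation of the semigroup is needed.
-/

/-! ### Generators of contraction semigroups -/

section ContractionSemigroups

variable {X : Type*} [NormedAddCommGroup X] [InnerProductSpace ℂ X]

/-- An operator `A` on an inner product space is dissipative if `Re ⟨A x, x⟩ ≤ 0` on its domain. -/
def IsDissipative (A : X →ₗ.[ℂ] X) : Prop :=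
  ∀ x : A.domain, (⟪(x : X), A x⟫_ℂ).re ≤ 0

theorem C0Semigroup.IsContractive.re_inner_nonpos {T : C0Semigroup X} (hT : T.IsContractive)
    {x y : X} (h : Tendsto (fun t : ℝ≥0 => (((t : ℝ) : ℂ)⁻¹) • (T.toFun t x - x))
      (𝓝[>] 0) (𝓝 y)) : (⟪x, y⟫_ℂ).re ≤ 0 := by
  have h2 : Tendsto (fun t : ℝ≥0 => (⟪x, (((t : ℝ) : ℂ)⁻¹) • (T.toFun t x - x)⟫_ℂ).re)
      (𝓝[>] 0) (𝓝 (⟪x, y⟫_ℂ).re) :=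
    (Complex.continuous_re.tendsto _).comp (tendsto_const_nhds.inner h)
  refine le_of_tendsto h2 (Eventually.of_forall fun t => ?_)
  have h3 : (⟪x, T.toFun t x⟫_ℂ).re ≤ ‖x‖ ^ 2 := by
    calc (⟪x, T.toFun t x⟫_ℂ).re ≤ ‖x‖ * ‖T.toFun t x‖ := re_inner_le_norm (𝕜 := ℂ) _ _
      _ ≤ ‖x‖ * ‖x‖ := by
        gcongr
        simpa using (T.toFun t).le_of_opNorm_le (hT t) x
      _ = _ := by ring
  have h4 : (⟪x, x⟫_ℂ).re = ‖x‖ ^ 2 := inner_self_eq_norm_sq (𝕜 := ℂ) _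
  rw [inner_smul_right, ← Complex.ofReal_inv, Complex.re_ofReal_mul, inner_sub_right,
    Complex.sub_re, h4]
  exact mul_nonpos_of_nonneg_of_nonpos (by positivity) (by linarith)

theorem C0Semigroup.HasGenerator.isDissipative {T : C0Semigroup X} {A : X →ₗ.[ℂ] X}
    (hA : T.HasGenerator A) (hT : T.IsContractive) : IsDissipative A := fun x =>
  hT.re_inner_nonpos ((hA x (A x)).1 (A.mem_graph x))

end ContractionSemigroups

theorem tendsto_coe_nhdsGT_zero : Tendsto ((↑) : ℝ≥0 → ℝ) (𝓝[>] 0) (𝓝[>] 0) :=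
  tendsto_nhdsWithin_iff.2 ⟨(NNReal.continuous_coe.tendsto 0).mono_left nhdsWithin_le_nhds,
    eventually_mem_nhdsWithin.mono fun _ ht => NNReal.coe_pos.2 ht⟩

section Resolvent

variable {X : Type*} [NormedAddCommGroup X] [NormedSpace ℂ X] [CompleteSpace X]

/-- The truncated Laplace transform `y = ∫₀¹ e⁻ᵗ T(t) x dt` lies in the domain of the generator,
with `y - A y = x - e⁻¹ T(1) x`. -/
theorem C0Semigroup.HasGenerator.exists_sub_eq_sub {T : C0Semigroup X} {A : X →ₗ.[ℂ] X}
    (hA : T.HasGenerator A) (x : X) :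
    ∃ y z : X, (y, z) ∈ A.graph ∧ y - z = x - (Real.exp (-1) : ℂ) • T.toFun 1 x := by
  set f : ℝ → X := fun t => (Real.exp (-t) : ℂ) • T.toFun t.toNNReal x with hf
  have hfc : Continuous f := by
    refine Continuous.smul (by fun_prop) ?_
    exact (T.continuous_orbit x).comp continuous_real_toNNReal
  set F : ℝ → X := fun h => ∫ t in (0 : ℝ)..h, f t with hF
  have hFd : ∀ h, HasDerivAt F (f h) h := fun h =>
    intervalIntegral.integral_hasDerivAt_right (hfc.intervalIntegrable _ _)
      (hfc.stronglyMeasurableAtFilter _ _) hfc.continuousAt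
  have hF0 : F 0 = 0 := by simp [hF]
  have hf0 : f 0 = x := by simp [hf, T.map_zero]
  have hf1 : f 1 = (Real.exp (-1) : ℂ) • T.toFun 1 x := by simp [hf]
  -- `T(h) y = eʰ (F(1 + h) - F(h))`, whose derivative at `h = 0` is `y + f(1) - f(0)`
  have hshift : ∀ h : ℝ≥0, T.toFun h (F 1) = (Real.exp h : ℂ) • (F (1 + h) - F h) := by
    intro h
    have h1 : F (1 + h) - F h = ∫ t in (0 : ℝ)..1, f (t + h) := by
      rw [intervalIntegral.integral_comp_add_right f (h : ℝ), zero_add]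
      exact intervalIntegral.integral_interval_sub_left (hfc.intervalIntegrable _ _)
        (hfc.intervalIntegrable _ _)
    rw [h1, hF, ← intervalIntegral.integral_smul,
      ← ContinuousLinearMap.intervalIntegral_comp_comm _ (hfc.intervalIntegrable _ _)]
    refine intervalIntegral.integral_congr fun t ht => ?_
    rw [Set.uIcc_of_le zero_le_one] at ht
    have h2 : (t + h).toNNReal = h + t.toNNReal := by
      rw [Real.toNNReal_add ht.1 h.coe_nonneg, Real.toNNReal_coe, add_comm]
    simp only [hf, h2, T.map_add, map_smul, ContinuousLinearMap.comp_apply, smul_smul]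
    rw [← Complex.ofReal_mul, ← Real.exp_add]
    congr 3
    ring
  have hder : HasDerivAt (fun h : ℝ => (Real.exp h : ℂ) • (F (1 + h) - F h))
      (F 1 + (f 1 - f 0)) 0 := by
    have e1 : HasDerivAt (fun h : ℝ => (Real.exp h : ℂ)) (Real.exp 0 : ℂ) 0 :=
      (Real.hasDerivAt_exp 0).ofReal_comp
    have e2 : HasDerivAt (fun h : ℝ => F (1 + h)) (f 1) 0 := by
      have := (hFd (1 + 0)).comp_const_add 1 0
      simpa using this
    have e3 := e1.smul (e2.sub (hFd 0))
    refine e3.congr_deriv ?_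
    simp [hF0, add_comm]
  refine ⟨F 1, F 1 + (f 1 - f 0), (hA _ _).2 ?_, by rw [hf0, hf1]; abel⟩
  refine (hder.tendsto_slope_zero_right.comp tendsto_coe_nhdsGT_zero).congr fun t => ?_
  simp only [Function.comp_apply, hshift, zero_add, Real.exp_zero, Complex.ofReal_one, one_smul,
    add_zero, hF0, sub_zero]
  rw [← Complex.ofReal_inv]
  exact (Complex.coe_smul _ _).symm

/-- The generator `A` of a contraction semigroup on a Banach space satisfies
`range (1 - A) = X`: the Neumann series inverts `1 - e⁻¹ T(1)`. -/
theorem C0Semigroup.HasGenerator.exists_sub_eq {T : C0Semigroup X} {A : X →ₗ.[ℂ] X}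
    (hA : T.HasGenerator A) (hT : T.IsContractive) (x : X) :
    ∃ y : A.domain, (y : X) - A y = x := by
  have hn : ‖(Real.exp (-1) : ℂ) • T.toFun 1‖ < 1 := by
    rw [norm_smul, Complex.norm_real, Real.norm_of_nonneg (Real.exp_pos _).le]
    calc Real.exp (-1) * ‖T.toFun 1‖ ≤ Real.exp (-1) * 1 := by gcongr; exact hT 1
      _ < 1 := by simp
  obtain ⟨u, hu⟩ := isUnit_one_sub_of_norm_lt_one hn
  have h1 : (1 - (Real.exp (-1) : ℂ) • T.toFun 1) ((↑u⁻¹ : X →L[ℂ] X) x) = x := by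
    rw [← hu, ← mul_apply_eq_comp, Units.mul_inv, one_apply_eq_self]
  obtain ⟨y, z, hyz, he⟩ := hA.exists_sub_eq_sub ((↑u⁻¹ : X →L[ℂ] X) x)
  obtain ⟨y', rfl, rfl⟩ := LinearPMap.mem_graph_iff _ |>.1 hyz
  refine ⟨y', he.trans ?_⟩
  simpa using h1

end Resolvent

/-! ### Closedness and density for dissipative operators -/

section Dissipative

variable {X : Type*} [NormedAddCommGroup X] [InnerProductSpace ℂ X] {A : X →ₗ.[ℂ] X}

/-- Dissipativity bounds `(l - A)⁻¹` by `1 / l`. -/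
theorem IsDissipative.mul_norm_le (hA : IsDissipative A) (l : ℝ) (x : A.domain) :
    l * ‖(x : X)‖ ≤ ‖(l : ℂ) • (x : X) - A x‖ := by
  rcases eq_or_ne (x : X) 0 with h0 | h0
  · simp [h0]
  have hx : 0 < ‖(x : X)‖ := norm_pos_iff.2 h0
  have h1 : (⟪(x : X), (l : ℂ) • (x : X) - A x⟫_ℂ).re ≤ ‖(x : X)‖ * ‖(l : ℂ) • (x : X) - A x‖ :=
    re_inner_le_norm (𝕜 := ℂ) _ _
  have h4 : (⟪(x : X), x⟫_ℂ).re = ‖(x : X)‖ ^ 2 := inner_self_eq_norm_sq (𝕜 := ℂ) _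
  rw [inner_sub_right, inner_smul_right, Complex.sub_re, Complex.re_ofReal_mul, h4] at h1
  have h5 := hA x
  refine le_of_mul_le_mul_left ?_ hx
  nlinarith

theorem IsDissipative.norm_le_norm_sub (hA : IsDissipative A) (x : A.domain) :
    ‖(x : X)‖ ≤ ‖(x : X) - A x‖ := by
  simpa using hA.mul_norm_le 1 x

/-- A dissipative operator with `range (1 - A) = X` is closed. -/
theorem IsDissipative.isClosed_graph (hA : IsDissipative A)
    (hs : ∀ x : X, ∃ y : A.domain, (y : X) - A y = x) : IsClosed (A.graph : Set (X × X)) := by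
  refine isClosed_of_closure_subset fun p hp => ?_
  obtain ⟨w, hw⟩ := hs (p.1 - p.2)
  obtain ⟨q, hq, hqp⟩ := mem_closure_iff_seq_limit.1 hp
  have h1 : Tendsto (fun n => (q n).1) atTop (𝓝 (w : X)) := by
    rw [tendsto_iff_norm_sub_tendsto_zero]
    have h2 : Tendsto (fun n => ‖((q n).1 - (q n).2) - (p.1 - p.2)‖) atTop (𝓝 0) := by
      rw [← tendsto_iff_norm_sub_tendsto_zero]
      exact ((continuous_fst.sub continuous_snd).tendsto p).comp hqp
    refine squeeze_zero (fun _ => norm_nonneg _) (fun n => ?_) h2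
    obtain ⟨y, hy1, hy2⟩ := LinearPMap.mem_graph_iff _ |>.1 (hq n)
    have h3 := hA.norm_le_norm_sub (y - w)
    rw [LinearPMap.map_sub, AddSubgroupClass.coe_sub] at h3
    rw [← hy1, ← hy2, ← hw]
    convert h3 using 2
    abel
  have h2 : p.1 = w := tendsto_nhds_unique ((continuous_fst.tendsto p).comp hqp) h1
  rw [h2, sub_right_inj] at hw
  have : p = ((w : X), A w) := Prod.ext h2 hw.symm
  rw [this]
  exact A.mem_graph w

/-- A dissipative operator with `range (1 - A) = X` on a Hilbert space is densely defined. If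
`z = y - A y` is orthogonal to the domain then `‖y‖² ≤ Re ⟨z, y⟩ = 0`. -/
theorem IsDissipative.dense_domain [CompleteSpace X] (hA : IsDissipative A)
    (hs : ∀ x : X, ∃ y : A.domain, (y : X) - A y = x) : Dense (A.domain : Set X) := by
  rw [Submodule.dense_iff_topologicalClosure_eq_top, Submodule.topologicalClosure_eq_top_iff,
    Submodule.eq_bot_iff]
  intro z hz
  obtain ⟨y, rfl⟩ := hs z
  have h1 := (Submodule.mem_orthogonal _ _).1 hz y y.2
  have h2 := congrArg Complex.re h1
  have h4 : (⟪(y : X), y⟫_ℂ).re = ‖(y : X)‖ ^ 2 := inner_self_eq_norm_sq (𝕜 := ℂ) _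
  rw [inner_sub_right, Complex.sub_re, h4, Complex.zero_re] at h2
  have h5 := hA y
  have h6 : y = 0 := by
    ext
    rw [ZeroMemClass.coe_zero, ← norm_eq_zero, ← sq_eq_zero_iff]
    exact le_antisymm (by linarith) (by positivity)
  simp [h6]

end Dissipative

/-! ### Exponentials of bounded dissipative operators -/

section BoundedDissipative

variable {X : Type*} [NormedAddCommGroup X] [InnerProductSpace ℂ X] [CompleteSpace X]
  {B C : X →L[ℂ] X}

theorem hasDerivAt_exp_smul_apply (B : X →L[ℂ] X) (x : X) (t : ℝ) :
    HasDerivAt (fun s : ℝ => NormedSpace.exp ((s : ℂ) • B) x)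
      (NormedSpace.exp ((t : ℂ) • B) (B x)) t := by
  have h : HasDerivAt (fun s : ℝ => NormedSpace.exp ((s : ℂ) • B))
      (NormedSpace.exp ((t : ℂ) • B) * B) t := by
    simpa [Function.comp_def] using
      (hasDerivAt_exp_smul_const B (t : ℂ)).scomp t Complex.ofRealCLM.hasDerivAt
  exact ((ContinuousLinearMap.apply ℂ X x).restrictScalars ℝ).hasFDerivAt.comp_hasDerivAt t h

theorem exp_add_apply_of_commute (h : Commute B C) (x : X) :
    NormedSpace.exp (B + C) x = NormedSpace.exp B (NormedSpace.exp C x) := by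
  let +nondep : NormedAlgebra ℚ (X →L[ℂ] X) := NormedAlgebra.restrictScalars ℚ ℂ (X →L[ℂ] X)
  rw [NormedSpace.exp_add_of_commute h, mul_apply_eq_comp]

theorem norm_exp_le_one (hB : ∀ x, (⟪x, B x⟫_ℂ).re ≤ 0) : ‖NormedSpace.exp B‖ ≤ 1 := by
  refine ContinuousLinearMap.opNorm_le_bound _ zero_le_one fun x => ?_
  set f : ℝ → X := fun t => NormedSpace.exp ((t : ℂ) • B) x with hf
  have hfd : ∀ t, HasDerivAt f (B (f t)) t := fun t => by
    refine (hasDerivAt_exp_smul_apply B x t).congr_deriv ?_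
    exact congrArg (· x) (Commute.exp_left ((Commute.refl B).smul_left (t : ℂ))).eq
  have hd : ∀ t, HasDerivAt (fun s => (⟪f s, f s⟫_ℂ).re)
      (⟪f t, B (f t)⟫_ℂ + ⟪B (f t), f t⟫_ℂ).re t := fun t =>
    Complex.reCLM.hasFDerivAt.comp_hasDerivAt t ((hfd t).inner ℂ (hfd t))
  have ha : Antitone fun s => (⟪f s, f s⟫_ℂ).re := by
    refine antitone_of_hasDerivAt_nonpos hd fun t => ?_
    have h1 : (⟪B (f t), f t⟫_ℂ).re = (⟪f t, B (f t)⟫_ℂ).re := inner_re_symm (𝕜 := ℂ) _ _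
    change _ ≤ (0 : ℝ)
    rw [Complex.add_re, h1]
    linarith [hB (f t)]
  have h01 := ha zero_le_one
  have hn : ∀ y : X, (⟪y, y⟫_ℂ).re = ‖y‖ ^ 2 := fun y => inner_self_eq_norm_sq (𝕜 := ℂ) _
  simp only [hn, hf, Complex.ofReal_one, one_smul, Complex.ofReal_zero, zero_smul,
    NormedSpace.exp_zero, one_apply_eq_self] at h01
  rw [one_mul]
  exact le_of_sq_le_sq h01 (norm_nonneg x)

theorem norm_exp_apply_le (hB : ∀ x, (⟪x, B x⟫_ℂ).re ≤ 0) (x : X) :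
    ‖NormedSpace.exp B x‖ ≤ ‖x‖ := by
  simpa using (NormedSpace.exp B).le_of_opNorm_le (norm_exp_le_one hB) x

/-- For commuting dissipative `B` and `C` the path `s ↦ exp (C + s (B - C)) x` has velocity
`exp ((1 - s) C + s B) (B - C) x`, of norm at most `‖B x - C x‖`. -/
theorem norm_exp_apply_sub_exp_apply_le (hB : ∀ x, (⟪x, B x⟫_ℂ).re ≤ 0)
    (hC : ∀ x, (⟪x, C x⟫_ℂ).re ≤ 0) (h : Commute B C) (x : X) :
    ‖NormedSpace.exp B x - NormedSpace.exp C x‖ ≤ ‖B x - C x‖ := by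
  have key : ∀ (s : ℝ) (y : X), NormedSpace.exp ((s : ℂ) • (B - C)) (NormedSpace.exp C y)
      = NormedSpace.exp ((s : ℂ) • B + ((1 - s : ℝ) : ℂ) • C) y := by
    intro s y
    rw [← exp_add_apply_of_commute ((h.sub_left (Commute.refl C)).smul_left _)]
    congr 2
    push_cast
    module
  have hcomm : NormedSpace.exp C ((B - C) x) = (B - C) (NormedSpace.exp C x) :=
    congrArg (· x) (Commute.exp_left ((h.symm).sub_right (Commute.refl C))).eq
  have hm := norm_image_sub_le_of_norm_deriv_le_segment_01'
    (f := fun s : ℝ => NormedSpace.exp ((s : ℂ) • (B - C)) (NormedSpace.exp C x))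
    (fun s _ => (hasDerivAt_exp_smul_apply (B - C) (NormedSpace.exp C x) s).hasDerivWithinAt)
    (C := ‖B x - C x‖) (fun s hs => by
      rw [← hcomm, key]
      refine norm_exp_apply_le (fun y => ?_) _
      simp only [add_apply, smul_apply, inner_add_right,
        inner_smul_right, Complex.add_re, Complex.re_ofReal_mul]
      exact add_nonpos (mul_nonpos_of_nonneg_of_nonpos hs.1 (hB y))
        (mul_nonpos_of_nonneg_of_nonpos (by linarith [hs.2]) (hC y)))
  rw [key, key] at hm
  simpa using hm

/-- A bound for the remainder of `exp B x = x + B x + ⋯`, from the mean value inequality for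
`s ↦ exp (s B) x - s B x` on `[0, 1]`. -/
theorem norm_exp_apply_sub_sub_le {δ : ℝ} (x : X)
    (hδ : ∀ s : ℝ, 0 ≤ s → s ≤ 1 → ‖NormedSpace.exp ((s : ℂ) • B) (B x) - B x‖ ≤ δ) :
    ‖NormedSpace.exp B x - x - B x‖ ≤ δ := by
  have hm := norm_image_sub_le_of_norm_deriv_le_segment_01'
    (f := fun s : ℝ => NormedSpace.exp ((s : ℂ) • B) x - s • B x)
    (fun s _ => ((hasDerivAt_exp_smul_apply B x s).sub
      ((hasDerivAt_id s).smul_const (B x))).hasDerivWithinAt)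
    (C := δ) (fun s hs => by simpa using hδ s hs.1 hs.2.le)
  convert hm using 2
  simp
  abel

end BoundedDissipative

/-! ### Strong holomorphy implies holomorphy in operator norm -/

/-- A bounded strongly holomorphic family of operators is holomorphic in operator norm: the Cauchy
estimate makes it locally Lipschitz, so that it is given by Cauchy's integral in operator norm. -/
theorem differentiableOn_of_apply {X Y : Type*} [NormedAddCommGroup X] [NormedSpace ℂ X]
    [NormedAddCommGroup Y] [NormedSpace ℂ Y] [CompleteSpace Y] {U : ℂ → X →L[ℂ] Y} {s : Set ℂ}
    (hs : IsOpen s) {M : ℝ} (hM : ∀ z ∈ s, ‖U z‖ ≤ M)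
    (hU : ∀ x, DifferentiableOn ℂ (fun z => U z x) s) : DifferentiableOn ℂ U s := by
  intro z₀ hz₀
  have hM0 : 0 ≤ M := (norm_nonneg _).trans (hM z₀ hz₀)
  obtain ⟨R, hR, hRs⟩ := Metric.isOpen_iff.1 hs z₀ hz₀
  obtain ⟨r, hr, rfl⟩ : ∃ r : ℝ≥0, 0 < r ∧ R = 4 * r :=
    ⟨(R / 4).toNNReal, by simpa using hR, by rw [Real.coe_toNNReal _ (by positivity)]; ring⟩
  have hr' : (0 : ℝ) < r := hr
  have hderiv : ∀ (x : X), ∀ z ∈ Metric.ball z₀ (2 * r), ‖deriv (fun z => U z x) z‖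
      ≤ M * ‖x‖ / r := by
    intro x z hz
    have hsub : Metric.closedBall z r ⊆ s := fun w hw => hRs <| by
      rw [Metric.mem_ball] at hz ⊢
      rw [Metric.mem_closedBall] at hw
      linarith [dist_triangle w z z₀]
    refine Complex.norm_deriv_le_of_forall_mem_sphere_norm_le hr'
      (((hU x).mono hsub).diffContOnCl_ball subset_rfl) fun w hw => ?_
    exact (U w).le_of_opNorm_le (hM w (hsub (Metric.sphere_subset_closedBall hw))) x
  have hball : Metric.ball z₀ (2 * r) ⊆ s := (Metric.ball_subset_ball (by linarith)).trans hRs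
  have hcont : ContinuousOn U (Metric.ball z₀ (2 * r)) := by
    refine LipschitzOnWith.continuousOn (K := (M / r).toNNReal) ?_
    refine LipschitzOnWith.of_dist_le_mul fun z hz w hw => ?_
    rw [Real.coe_toNNReal _ (by positivity), dist_eq_norm, dist_eq_norm]
    refine ContinuousLinearMap.opNorm_le_bound _ (by positivity) fun x => ?_
    refine ((convex_ball z₀ (2 * r : ℝ)).norm_image_sub_le_of_norm_deriv_le
      (fun y hy => (hU x).differentiableAt (hs.mem_nhds (hball hy))) (hderiv x) hw hz).trans
        (le_of_eq ?_)
    ring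
  have hsub : Metric.closedBall z₀ r ⊆ Metric.ball z₀ (2 * r) :=
    Metric.closedBall_subset_ball (by linarith)
  have hint : CircleIntegrable U z₀ r :=
    (hcont.mono (Metric.sphere_subset_closedBall.trans hsub)).circleIntegrable r.2
  have hps := hasFPowerSeriesOn_cauchy_integral hint hr
  refine ((hps.differentiableOn.congr fun z hz => ?_).differentiableAt
    (Metric.eball_mem_nhds _ (by simpa using hr))).differentiableWithinAt
  rw [Metric.eball_coe, Metric.mem_ball] at hz
  ext x
  have h1 := ((hU x).mono (hsub.trans hball)).circleIntegral_sub_inv_smul (w := z) hz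
  have hint' : CircleIntegrable (fun w => (w - z)⁻¹ • U w) z₀ r := by
    refine ContinuousOn.circleIntegrable r.2 (ContinuousOn.smul (f := fun w => (w - z)⁻¹) ?_
      (hcont.mono (Metric.sphere_subset_closedBall.trans hsub)))
    refine (continuous_sub_right z).continuousOn.inv₀ fun w hw h0 => ?_
    rw [sub_eq_zero] at h0
    rw [h0, Metric.mem_sphere] at hw
    exact hz.ne hw
  have h2 : (∮ w in C(z₀, r), (w - z)⁻¹ • U w) x = ∮ w in C(z₀, r), (w - z)⁻¹ • U w x := by
    simp only [circleIntegral]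
    exact ((ContinuousLinearMap.apply ℂ Y x).intervalIntegral_comp_comm hint'.out).symm
  rw [smul_apply, h2, h1, smul_smul, inv_mul_cancel₀ Complex.two_pi_I_ne_zero, one_smul]

/-! ### Resolvents and Yosida approximations -/

section Yosida

variable {X : Type*} [NormedAddCommGroup X] [InnerProductSpace ℂ X] {A : X →ₗ.[ℂ] X}

/-- `R` is a right inverse of `l - A`. For dissipative `A` and `l > 0` it is then also a left
inverse (`IsResolvent.apply_smul_sub`). -/
def IsResolvent (A : X →ₗ.[ℂ] X) (l : ℝ) (R : X →L[ℂ] X) : Prop :=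
  ∀ y, ∃ x : A.domain, (x : X) = R y ∧ (l : ℂ) • (x : X) - A x = y

theorem IsDissipative.eq_of_smul_sub_eq (hA : IsDissipative A) {l : ℝ} (hl : 0 < l)
    {x y : A.domain} (h : (l : ℂ) • (x : X) - A x = (l : ℂ) • (y : X) - A y) : x = y := by
  have h1 := hA.mul_norm_le l (x - y)
  have h2 : (l : ℂ) • ((x - y : A.domain) : X) - A (x - y) = 0 := by
    rw [LinearPMap.map_sub, AddSubgroupClass.coe_sub, ← sub_eq_zero.2 h]
    module
  rw [h2, norm_zero] at h1
  have h3 : ‖((x - y : A.domain) : X)‖ ≤ 0 := nonpos_of_mul_nonpos_right h1 hl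
  rw [norm_le_zero_iff, ZeroMemClass.coe_eq_zero] at h3
  exact sub_eq_zero.1 h3

theorem IsDissipative.exists_isResolvent (hA : IsDissipative A) {l : ℝ} (hl : 0 < l)
    (hs : ∀ y : X, ∃ x : A.domain, (l : ℂ) • (x : X) - A x = y) :
    ∃ R : X →L[ℂ] X, IsResolvent A l R := by
  choose r hr using hs
  let R : X →ₗ[ℂ] X :=
    { toFun := fun y => r y
      map_add' := fun y z => by
        have : r (y + z) = r y + r z := hA.eq_of_smul_sub_eq hl <| by
          rw [hr, LinearPMap.map_add, Submodule.coe_add]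
          nth_rewrite 1 [← hr y, ← hr z]
          module
        rw [this, Submodule.coe_add]
      map_smul' := fun c y => by
        have : r (c • y) = c • r y := hA.eq_of_smul_sub_eq hl <| by
          rw [hr, LinearPMap.map_smul, Submodule.coe_smul]
          nth_rewrite 1 [← hr y]
          module
        rw [this, Submodule.coe_smul, RingHom.id_apply] }
  refine ⟨R.mkContinuous l⁻¹ fun y => ?_, fun y => ⟨r y, rfl, hr y⟩⟩
  rw [inv_mul_eq_div, le_div_iff₀' hl]
  have := hA.mul_norm_le l (r y)
  rwa [hr] at this

/-- The Yosida approximation `l (l R - 1) = l A R`, where `R = (l - A)⁻¹`. -/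
def yosida (l : ℝ) (R : X →L[ℂ] X) : X →L[ℂ] X :=
  (l : ℂ) • ((l : ℂ) • R - 1)

theorem yosida_apply (l : ℝ) (R : X →L[ℂ] X) (y : X) :
    yosida l R y = (l : ℂ) • ((l : ℂ) • R y - y) := rfl

theorem IsResolvent.apply_smul_sub {l : ℝ} {R : X →L[ℂ] X} (hR : IsResolvent A l R)
    (hA : IsDissipative A) (hl : 0 < l) (x : A.domain) : R ((l : ℂ) • (x : X) - A x) = x := by
  obtain ⟨y, hy, h⟩ := hR ((l : ℂ) • (x : X) - A x)
  rw [← hy, hA.eq_of_smul_sub_eq hl h]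

/-- Resolvents commute, by the resolvent identity `R_l - R_m = (m - l) R_l R_m`. -/
theorem IsResolvent.commute {l m : ℝ} {R Q : X →L[ℂ] X} (hR : IsResolvent A l R)
    (hQ : IsResolvent A m Q) (hA : IsDissipative A) (hl : 0 < l) (hm : 0 < m) :
    Commute R Q := by
  have key : ∀ {l m : ℝ} {R Q : X →L[ℂ] X}, IsResolvent A l R → IsResolvent A m Q → 0 < l →
      ∀ y, R y = Q y + ((m - l : ℝ) : ℂ) • R (Q y) := by
    intro l m R Q hR hQ hl y
    obtain ⟨w, hw, h⟩ := hQ y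
    have h1 : y = ((l : ℂ) • (w : X) - A w) + ((m - l : ℝ) : ℂ) • (w : X) := by
      rw [← h]; push_cast; module
    rw [h1, map_add, hR.apply_smul_sub hA hl, map_smul, ← h1, hw]
  have h1 := key hR hQ hl
  have h2 := key hQ hR hm
  ext y
  rw [mul_apply_eq_comp, mul_apply_eq_comp]
  rcases eq_or_ne l m with rfl | hlm
  · have h3 : ∀ y, R y = Q y := fun y => by simpa using h1 y
    simp only [h3]
  · have h3 : ((m - l : ℝ) : ℂ) • (R (Q y) - Q (R y)) = 0 := by
      have h4 := h1 y
      have h5 : ((l - m : ℝ) : ℂ) • Q (R y) = Q y - R y := by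
        rw [eq_sub_iff_add_eq, add_comm]; exact (h2 y).symm
      rw [smul_sub, sub_eq_zero, ← add_right_inj (Q y), ← h4]
      have h6 : ((m - l : ℝ) : ℂ) • Q (R y) = -(Q y - R y) := by
        rw [← h5]; push_cast; module
      rw [h6]; abel
    rw [smul_eq_zero, Complex.ofReal_eq_zero, sub_eq_zero] at h3
    exact sub_eq_zero.1 (h3.resolve_left hlm.symm)

theorem IsResolvent.commute_yosida {l m : ℝ} {R Q : X →L[ℂ] X} (hR : IsResolvent A l R)
    (hQ : IsResolvent A m Q) (hA : IsDissipative A) (hl : 0 < l) (hm : 0 < m) :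
    Commute (yosida l R) (yosida m Q) := by
  have h := hR.commute hQ hA hl hm
  refine Commute.smul_left (Commute.smul_right ?_ _) _
  exact ((h.smul_left _).smul_right _ |>.sub_right (Commute.one_right _)).sub_left
    (Commute.one_left _)

/-- The numerical range of the Yosida approximation lies in every closed half plane through the
origin which contains the negative real axis and the numerical range of `A`: with `x = R y` one has
`⟨A_l y, y⟩ = l² ⟨A x, x⟩ - l ‖A x‖²`. -/
theorem IsResolvent.re_inner_yosida_nonpos {l : ℝ} {R : X →L[ℂ] X} (hR : IsResolvent A l R)
    (hl : 0 < l) {z : ℂ} (hz : 0 ≤ z.re) (h : ∀ x : A.domain, (z * ⟪(x : X), A x⟫_ℂ).re ≤ 0)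
    (y : X) : (⟪y, (z • yosida l R) y⟫_ℂ).re ≤ 0 := by
  obtain ⟨x, hx, rfl⟩ := hR y
  have h1 : yosida l R ((l : ℂ) • (x : X) - A x) = (l : ℂ) • A x := by
    rw [yosida_apply, ← hx]; congr 1; abel
  have h2 : ⟪(l : ℂ) • (x : X) - A x, (z • yosida l R) ((l : ℂ) • (x : X) - A x)⟫_ℂ
      = ((l ^ 2 : ℝ) : ℂ) * (z * ⟪(x : X), A x⟫_ℂ) - ((l * ‖A x‖ ^ 2 : ℝ) : ℂ) * z := by
    rw [smul_apply, h1, inner_smul_right, inner_smul_right, inner_sub_left, inner_smul_left,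
      inner_self_eq_norm_sq_to_K, Complex.conj_ofReal]
    push_cast
    simp only [Complex.coe_algebraMap]
    ring
  rw [h2, Complex.sub_re, Complex.re_ofReal_mul, Complex.re_ofReal_mul]
  have h3 := mul_nonpos_of_nonneg_of_nonpos (sq_nonneg l) (h x)
  have h4 : 0 ≤ l * ‖A x‖ ^ 2 * z.re := by positivity
  linarith

theorem IsResolvent.norm_apply_le {l : ℝ} {R : X →L[ℂ] X} (hR : IsResolvent A l R)
    (hA : IsDissipative A) (y : X) : l * ‖R y‖ ≤ ‖y‖ := by
  obtain ⟨x, hx, rfl⟩ := hR y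
  rw [← hx]
  exact hA.mul_norm_le l x

theorem IsResolvent.yosida_apply_domain {l : ℝ} {R : X →L[ℂ] X} (hR : IsResolvent A l R)
    (hA : IsDissipative A) (hl : 0 < l) (x : A.domain) :
    yosida l R x = (l : ℂ) • R (A x) := by
  have h := hR.apply_smul_sub hA hl x
  rw [map_sub, map_smul] at h
  rw [yosida_apply]
  congr 1
  nth_rewrite 2 [← h]
  abel

/-- The Yosida approximations converge to `A` on the domain of `A`. As `A_l x = l R A x`, this
amounts to the strong convergence of `l R` to the identity. -/
theorem tendsto_yosida (hA : IsDissipative A) (hd : Dense (A.domain : Set X)) {l : ℕ → ℝ}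
    (hl : ∀ n, 0 < l n) (hl' : Tendsto l atTop atTop) {R : ℕ → X →L[ℂ] X}
    (hR : ∀ n, IsResolvent A (l n) (R n)) (x : A.domain) :
    Tendsto (fun n => yosida (l n) (R n) x) atTop (𝓝 (A x)) := by
  simp only [fun n => (hR n).yosida_apply_domain hA (hl n) x]
  generalize A x = y
  rw [Metric.tendsto_atTop]
  intro ε hε
  obtain ⟨w, hw, hyw⟩ := hd.exists_dist_lt y (show 0 < ε / 3 by positivity)
  have h1 : Tendsto (fun n => ‖A ⟨w, hw⟩‖ / l n) atTop (𝓝 0) := tendsto_const_nhds.div_atTop hl'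
  obtain ⟨N, hN⟩ := eventually_atTop.1 (h1.eventually_lt_const (show 0 < ε / 3 by positivity))
  refine ⟨N, fun n hn => ?_⟩
  have h2 : ‖(l n : ℂ) • R n w - w‖ ≤ ‖A ⟨w, hw⟩‖ / l n := by
    have h3 := (hR n).apply_smul_sub hA (hl n) ⟨w, hw⟩
    rw [map_sub, map_smul] at h3
    have h4 : (l n : ℂ) • R n w - w = R n (A ⟨w, hw⟩) :=
      sub_eq_iff_eq_add'.2 (sub_eq_iff_eq_add.1 h3)
    rw [h4, le_div_iff₀' (hl n)]
    exact (hR n).norm_apply_le hA _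
  have h5 : ‖(l n : ℂ) • R n (y - w)‖ ≤ ‖y - w‖ := by
    rw [norm_smul, Complex.norm_real, Real.norm_of_nonneg (hl n).le]
    exact (hR n).norm_apply_le hA _
  rw [dist_eq_norm] at hyw ⊢
  have h6 : (l n : ℂ) • R n y - y
      = (l n : ℂ) • R n (y - w) + ((l n : ℂ) • R n w - w) - (y - w) := by
    rw [map_sub]; module
  rw [h6]
  have := hN n hn
  linarith [norm_sub_le ((l n : ℂ) • R n (y - w) + ((l n : ℂ) • R n w - w)) (y - w),
    norm_add_le ((l n : ℂ) • R n (y - w)) ((l n : ℂ) • R n w - w)]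

end Yosida

/-! ### Limits of exponentials -/

/-- Let `B n` be commuting operators such that `z • B n` is dissipative for `z ∈ Z`. If `B n x`
converges for `x` in a dense set, then `exp (z • B n)` converges strongly, uniformly on bounded
subsets of `Z`. -/
theorem exists_tendstoUniformlyOn_exp {X : Type*} [NormedAddCommGroup X] [InnerProductSpace ℂ X]
    [CompleteSpace X] {B : ℕ → X →L[ℂ] X} {Z : Set ℂ} {D : Set X} (hc : ∀ m n, Commute (B m) (B n))
    (hB : ∀ z ∈ Z, ∀ n x, (⟪x, (z • B n) x⟫_ℂ).re ≤ 0) (hD : Dense D)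
    (hlim : ∀ x ∈ D, ∃ y, Tendsto (fun n => B n x) atTop (𝓝 y)) :
    ∃ U : ℂ → X →L[ℂ] X, ∀ (x : X) (r : ℝ),
      TendstoUniformlyOn (fun n z => NormedSpace.exp (z • B n) x) (fun z => U z x) atTop
        (Z ∩ Metric.ball 0 r) := by
  have hcauchy : ∀ (x : X) (r : ℝ),
      UniformCauchySeqOn (fun n z => NormedSpace.exp (z • B n) x) atTop (Z ∩ Metric.ball 0 r) := by
    intro x r
    rw [Metric.uniformCauchySeqOn_iff]
    intro ε hε
    obtain ⟨w, hw, hxw⟩ := hD.exists_dist_lt x (show 0 < ε / 3 by positivity)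
    obtain ⟨y, hy⟩ := hlim w hw
    obtain ⟨N, hN⟩ := Metric.cauchySeq_iff.1 hy.cauchySeq (ε / 3 / (|r| + 1)) (by positivity)
    refine ⟨N, fun m hm n hn z hz => ?_⟩
    have h1 := norm_exp_apply_le (hB z hz.1 m) (x - w)
    have h2 := norm_exp_apply_le (hB z hz.1 n) (x - w)
    have h3 : ‖NormedSpace.exp (z • B m) w - NormedSpace.exp (z • B n) w‖ ≤ ε / 3 := by
      refine (norm_exp_apply_sub_exp_apply_le (hB z hz.1 m) (hB z hz.1 n)
        (((hc m n).smul_left z).smul_right z) w).trans ?_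
      have h4 := (hN m hm n hn).le
      rw [dist_eq_norm] at h4
      have h5 : ‖z‖ ≤ |r| + 1 := by
        have := mem_ball_zero_iff.1 hz.2
        linarith [le_abs_self r]
      rw [smul_apply, smul_apply, ← smul_sub, norm_smul]
      calc ‖z‖ * ‖B m w - B n w‖ ≤ (|r| + 1) * (ε / 3 / (|r| + 1)) := by gcongr
        _ = ε / 3 := by field_simp
    rw [dist_eq_norm] at hxw ⊢
    have h6 : NormedSpace.exp (z • B m) x - NormedSpace.exp (z • B n) x
        = NormedSpace.exp (z • B m) (x - w)
          + (NormedSpace.exp (z • B m) w - NormedSpace.exp (z • B n) w)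
          - NormedSpace.exp (z • B n) (x - w) := by
      rw [map_sub, map_sub]; abel
    rw [h6]
    refine (norm_sub_le _ _).trans_lt ?_
    linarith [norm_add_le (NormedSpace.exp (z • B m) (x - w))
      (NormedSpace.exp (z • B m) w - NormedSpace.exp (z • B n) w)]
  have hmem : ∀ z ∈ Z, z ∈ Z ∩ Metric.ball 0 (‖z‖ + 1) := fun z hz =>
    ⟨hz, mem_ball_zero_iff.2 (lt_add_one _)⟩
  have hex : ∀ z, ∃ L : X →L[ℂ] X, z ∈ Z → ∀ x,
      Tendsto (fun n => NormedSpace.exp (z • B n) x) atTop (𝓝 (L x)) := by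
    intro z
    by_cases hz : z ∈ Z
    · choose f hf using fun x =>
        cauchySeq_tendsto_of_complete ((hcauchy x (‖z‖ + 1)).cauchySeq (hmem z hz))
      exact ⟨continuousLinearMapOfTendsto (fun n => NormedSpace.exp (z • B n))
        (tendsto_pi_nhds.2 hf), fun _ => hf⟩
    · exact ⟨0, fun h => absurd h hz⟩
  choose U hU using hex
  exact ⟨U, fun x r => (hcauchy x r).tendstoUniformlyOn_of_tendsto fun z hz => hU z hz.1 x⟩

/-! ### Sectorial operators generate analytic semigroups -/

/-- The closed sector around the positive real axis whose sides have slope `± 1 / K`. -/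
def closedSector (K : ℝ) : Set ℂ := {z | K * |z.im| ≤ z.re}

theorem add_mem_closedSector {K : ℝ} (hK : 0 < K) {z w : ℂ} (hz : z ∈ closedSector K)
    (hw : w ∈ closedSector K) : z + w ∈ closedSector K := by
  change K * |(z + w).im| ≤ (z + w).re
  have h1 : K * |z.im| ≤ z.re := hz
  have h2 : K * |w.im| ≤ w.re := hw
  rw [Complex.add_im, Complex.add_re]
  nlinarith [abs_add_le z.im w.im]

theorem ofReal_mem_closedSector (K : ℝ) {t : ℝ} (ht : 0 ≤ t) : (t : ℂ) ∈ closedSector K := by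
  simpa [closedSector] using ht

theorem sector_arctan_subset_interior {K : ℝ} (hK : 0 < K) :
    C0Semigroup.sector (Real.arctan K⁻¹) ⊆ interior (closedSector K) := by
  have ho : IsOpen {z : ℂ | K * |z.im| < z.re} :=
    isOpen_lt (by fun_prop) (by fun_prop)
  have hsub : {z : ℂ | K * |z.im| < z.re} ⊆ closedSector K := fun z hz =>
    le_of_lt (show K * |z.im| < z.re from hz)
  intro z hz'
  refine interior_maximal hsub ho ?_
  obtain ⟨hz0, hz⟩ := hz'
  have hpi := Real.arctan_lt_pi_div_two K⁻¹
  have hcos : 0 < Real.cos |z.arg| :=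
    Real.cos_pos_of_mem_Ioo ⟨by linarith [abs_nonneg z.arg, Real.pi_pos], hz.trans hpi⟩
  have htan : Real.tan |z.arg| < K⁻¹ := by
    rw [← Real.tan_arctan K⁻¹]
    exact Real.tan_lt_tan_of_nonneg_of_lt_pi_div_two (abs_nonneg _) hpi hz
  rw [Real.tan_eq_sin_div_cos, div_lt_iff₀ hcos, inv_mul_eq_div, lt_div_iff₀' hK] at htan
  have hsin : |Real.sin z.arg| = Real.sin |z.arg| :=
    Real.abs_sin_eq_sin_abs_of_abs_le_pi (Complex.abs_arg_le_pi z)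
  rw [Real.cos_abs] at htan
  change K * |z.im| < z.re
  rw [← Complex.norm_mul_sin_arg, ← Complex.norm_mul_cos_arg, abs_mul, abs_norm, hsin]
  have := mul_lt_mul_of_pos_left htan (norm_pos_iff.2 hz0)
  linarith

/-- An operator `A` on a Hilbert space, of which the numerical range lies in a sector around the
negative real axis and for which `l - A` is surjective for `l > 0`, generates an analytic
semigroup: the strong limit of the exponentials of the Yosida approximations of `A`. -/
theorem exists_analytic_semigroup_of_sectorial {X : Type*} [NormedAddCommGroup X]
    [InnerProductSpace ℂ X] [CompleteSpace X] {A : X →ₗ.[ℂ] X} {K : ℝ} (hK : 0 < K)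
    (hsec : ∀ x : A.domain, |(⟪(x : X), A x⟫_ℂ).im| ≤ K * -(⟪(x : X), A x⟫_ℂ).re)
    (hs : ∀ l : ℝ, 0 < l → ∀ y : X, ∃ x : A.domain, (l : ℂ) • (x : X) - A x = y) :
    ∃ T : C0Semigroup X, T.HasGenerator A ∧ T.IsAnalytic := by
  have hA : IsDissipative A := fun x => by
    have := nonneg_of_mul_nonneg_right ((abs_nonneg _).trans (hsec x)) hK
    linarith
  have hs1 : ∀ y : X, ∃ x : A.domain, (x : X) - A x = y := fun y => by
    simpa using hs 1 one_pos y
  have hd := hA.dense_domain hs1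
  set l : ℕ → ℝ := fun n => n + 1 with hldef
  have hl : ∀ n, 0 < l n := fun n => by positivity
  have hl' : Tendsto l atTop atTop :=
    tendsto_atTop_add_const_right _ _ tendsto_natCast_atTop_atTop
  choose R hR using fun n => hA.exists_isResolvent (hl n) (hs (l n) (hl n))
  set B : ℕ → X →L[ℂ] X := fun n => yosida (l n) (R n) with hBdef
  set Z : Set ℂ := closedSector K with hZdef
  have hre : ∀ z ∈ Z, 0 ≤ z.re := fun z hz =>
    (mul_nonneg hK.le (abs_nonneg _)).trans hz
  -- the sectors are complementary: `Re (z c) ≤ 0` for `z ∈ Z` and `c` in the numerical range of `A`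
  have hB : ∀ z ∈ Z, ∀ n x, (⟪x, (z • B n) x⟫_ℂ).re ≤ 0 := by
    intro z hz n
    refine (hR n).re_inner_yosida_nonpos (hl n) (hre z hz) fun x => ?_
    rw [Complex.mul_re]
    have h1 := hsec x
    have h2 : K * |z.im| ≤ z.re := hz
    have h3 := abs_le.1 ((abs_mul z.im (⟪(x : X), A x⟫_ℂ).im).le.trans
      (mul_le_mul_of_nonneg_left h1 (abs_nonneg z.im)))
    have h4 := mul_le_mul_of_nonneg_right h2 (neg_nonneg.2 (hA x))
    nlinarith [h3.1]
  have hBlim : ∀ x : A.domain, Tendsto (fun n => B n x) atTop (𝓝 (A x)) :=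
    tendsto_yosida hA hd hl hl' hR
  obtain ⟨U, hU⟩ := exists_tendstoUniformlyOn_exp
    (fun m n => (hR m).commute_yosida (hR n) hA (hl m) (hl n)) hB hd
    (fun x hx => ⟨_, hBlim ⟨x, hx⟩⟩)
  have hUt : ∀ z ∈ Z, ∀ x, Tendsto (fun n => NormedSpace.exp (z • B n) x) atTop (𝓝 (U z x)) :=
    fun z hz x => (hU x (‖z‖ + 1)).tendsto_at ⟨hz, mem_ball_zero_iff.2 (lt_add_one _)⟩
  have hUl : ∀ x, TendstoLocallyUniformlyOn (fun n z => NormedSpace.exp (z • B n) x)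
      (fun z => U z x) atTop Z := fun x u hu z _ =>
    ⟨Z ∩ Metric.ball 0 (‖z‖ + 1), inter_mem_nhdsWithin _
      (Metric.isOpen_ball.mem_nhds (mem_ball_zero_iff.2 (lt_add_one _))), hU x _ u hu⟩
  have hUn : ∀ z ∈ Z, ‖U z‖ ≤ 1 := fun z hz =>
    ContinuousLinearMap.opNorm_le_bound _ zero_le_one fun x => by
      rw [one_mul]
      exact le_of_tendsto (hUt z hz x).norm
        (Eventually.of_forall fun n => norm_exp_apply_le (hB z hz n) x)
  have hU0 : U 0 = ContinuousLinearMap.id ℂ X := by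
    ext x
    refine tendsto_nhds_unique (hUt 0 (by simpa using ofReal_mem_closedSector K le_rfl) x) ?_
    simp
  have hUadd : ∀ z ∈ Z, ∀ w ∈ Z, U (z + w) = (U z).comp (U w) := by
    intro z hz w hw
    ext x
    refine tendsto_nhds_unique (hUt _ (add_mem_closedSector hK hz hw) x) ?_
    have h1 : Tendsto (fun n => NormedSpace.exp (z • B n) (NormedSpace.exp (w • B n) x - U w x))
        atTop (𝓝 0) := by
      refine squeeze_zero_norm (fun n => norm_exp_apply_le (hB z hz n) _) ?_
      exact tendsto_iff_norm_sub_tendsto_zero.1 (hUt w hw x)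
    have h2 := h1.add (hUt z hz (U w x))
    rw [zero_add] at h2
    refine h2.congr fun n => ?_
    rw [map_sub, sub_add_cancel, add_smul,
      exp_add_apply_of_commute (((Commute.refl (B n)).smul_left z).smul_right w)]
  have hexp : ∀ n x, Continuous fun z : ℂ => NormedSpace.exp (z • B n) x := fun n x =>
    continuous_iff_continuousAt.2 fun z =>
      ((hasDerivAt_exp_smul_const (B n) z).continuousAt).clm_apply continuousAt_const
  have hUc : ∀ x, ContinuousOn (fun z => U z x) Z := fun x =>
    (hUl x).continuousOn (Frequently.of_forall fun n => (hexp n x).continuousOn)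
  have hUd : DifferentiableOn ℂ U (interior Z) := by
    refine differentiableOn_of_apply isOpen_interior (fun z hz => hUn z (interior_subset hz))
      fun x => ((hUl x).mono interior_subset).differentiableOn
        (Eventually.of_forall fun n => ?_) isOpen_interior
    exact fun z _ => ((hasDerivAt_exp_smul_const (B n) z).differentiableAt.clm_apply
      (differentiableAt_const x)).differentiableWithinAt
  have hZ0 : (0 : ℂ) ∈ Z := by simpa using ofReal_mem_closedSector K le_rfl
  have hZr : ∀ t : ℝ≥0, ((t : ℝ) : ℂ) ∈ Z := fun t => ofReal_mem_closedSector K t.2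
  let T : C0Semigroup X :=
    { toFun := fun t => U ((t : ℝ) : ℂ)
      map_zero := by simpa using hU0
      map_add := fun s t => by
        simpa using hUadd _ (hZr s) _ (hZr t)
      continuous_orbit := fun x =>
        (hUc x).comp_continuous (Complex.continuous_ofReal.comp NNReal.continuous_coe) hZr }
  have hT : T.IsContractive := fun t => hUn _ (hZr t)
  have hTA : ∀ x : A.domain,
      Tendsto (fun t : ℝ≥0 => (((t : ℝ) : ℂ)⁻¹) • (T.toFun t x - x)) (𝓝[>] 0) (𝓝 (A x)) := by
    intro x
    -- `U(t) x - x - t A x` is estimated by means of `exp (s B n) A x - A x`, `0 ≤ s ≤ t`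
    have key : ∀ (δ : ℝ) (t : ℝ≥0), (∀ s : ℝ≥0, s ≤ t → ‖U ((s : ℝ) : ℂ) (A x) - A x‖ ≤ δ) →
        ‖U ((t : ℝ) : ℂ) x - x - ((t : ℝ) : ℂ) • A x‖ ≤ t * δ := by
      intro δ t hδ
      have hkey : ∀ ε : ℝ, 0 < ε →
          ‖U ((t : ℝ) : ℂ) x - x - ((t : ℝ) : ℂ) • A x‖ ≤ t * (δ + 3 * ε) := by
        intro ε hε
        refine le_of_tendsto (((hUt _ (hZr t) x).sub_const (x : X)).sub
          ((hBlim x).const_smul ((t : ℝ) : ℂ))).norm ?_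
        filter_upwards [Metric.tendstoUniformlyOn_iff.1 (hU (A x) (t + 1)) ε hε,
          Metric.tendsto_nhds.1 (hBlim x) ε hε] with n hn1 hn2
        refine norm_exp_apply_sub_sub_le (B := ((t : ℝ) : ℂ) • B n) (x : X) fun s hs0 hs1 => ?_
        lift s to ℝ≥0 using hs0
        have hst : (((s : ℝ) : ℂ) * ((t : ℝ) : ℂ)) = (((s * t : ℝ≥0) : ℝ) : ℂ) := by push_cast; rfl
        have hstt : s * t ≤ t := mul_le_of_le_one_left' hs1
        rw [smul_smul, smul_apply, map_smul, ← smul_sub, norm_smul, Complex.norm_real,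
          Real.norm_of_nonneg t.coe_nonneg, hst]
        refine mul_le_mul_of_nonneg_left ?_ t.coe_nonneg
        set r : ℝ≥0 := s * t
        have h1 := hn1 ((r : ℝ) : ℂ) ⟨hZr r, by
          rw [mem_ball_zero_iff, Complex.norm_real, Real.norm_of_nonneg r.coe_nonneg]
          have : (r : ℝ) ≤ t := hstt
          linarith⟩
        have h2 := hδ r hstt
        have h3 := norm_exp_apply_le (hB _ (hZr r) n) (B n x - A x)
        rw [dist_eq_norm] at hn2
        rw [dist_eq_norm'] at h1
        have h4 : NormedSpace.exp (((r : ℝ) : ℂ) • B n) (B n x) - B n x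
            = NormedSpace.exp (((r : ℝ) : ℂ) • B n) (B n x - A x)
              + (NormedSpace.exp (((r : ℝ) : ℂ) • B n) (A x) - U ((r : ℝ) : ℂ) (A x))
              + (U ((r : ℝ) : ℂ) (A x) - A x) - (B n x - A x) := by
          rw [map_sub]; abel
        rw [h4]
        have h5 := norm_add₃_le (a := NormedSpace.exp (((r : ℝ) : ℂ) • B n) (B n x - A x))
          (b := NormedSpace.exp (((r : ℝ) : ℂ) • B n) (A x) - U ((r : ℝ) : ℂ) (A x))
          (c := U ((r : ℝ) : ℂ) (A x) - A x)
        refine (norm_sub_le _ _).trans ?_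
        linarith
      have hlim : Tendsto (fun ε : ℝ => (t : ℝ) * (δ + 3 * ε)) (𝓝[>] 0) (𝓝 (t * δ)) := by
        have : Continuous fun ε : ℝ => (t : ℝ) * (δ + 3 * ε) := by fun_prop
        simpa using (this.tendsto 0).mono_left nhdsWithin_le_nhds
      exact ge_of_tendsto hlim (eventually_mem_nhdsWithin.mono fun ε hε => hkey ε hε)
    rw [Metric.tendsto_nhds]
    intro ε hε
    have h0 : Tendsto (fun t : ℝ≥0 => T.toFun t (A x)) (𝓝 0) (𝓝 (A x)) := by
      simpa [T.map_zero] using (T.continuous_orbit (A x)).tendsto 0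
    obtain ⟨η, hη, h1⟩ := Metric.eventually_nhds_iff.1 (Metric.tendsto_nhds.1 h0 (ε / 2)
      (by positivity))
    have h2 : ∀ᶠ t : ℝ≥0 in 𝓝[>] 0, dist t 0 < η :=
      nhdsWithin_le_nhds (Metric.ball_mem_nhds 0 hη)
    filter_upwards [h2, eventually_mem_nhdsWithin] with t ht ht0
    have ht0' : (0 : ℝ) < t := NNReal.coe_pos.2 ht0
    have h3 := key (ε / 2) t fun s hs => by
      rw [← dist_eq_norm]
      refine (h1 (lt_of_le_of_lt ?_ ht)).le
      simpa [NNReal.dist_eq] using hs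
    have htc : ((t : ℝ) : ℂ) ≠ 0 := Complex.ofReal_ne_zero.2 ht0'.ne'
    have h4 : ((t : ℝ) : ℂ)⁻¹ • (T.toFun t x - x) - A x
        = ((t : ℝ) : ℂ)⁻¹ • (U ((t : ℝ) : ℂ) x - x - ((t : ℝ) : ℂ) • A x) := by
      rw [smul_sub _ (_ - _), smul_smul, inv_mul_cancel₀ htc, one_smul]
    rw [dist_eq_norm, h4, norm_smul, norm_inv, Complex.norm_real, Real.norm_of_nonneg t.coe_nonneg,
      inv_mul_lt_iff₀ ht0']
    refine h3.trans_lt ?_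
    gcongr
    linarith
  refine ⟨T, fun x y => ⟨fun h => ?_, fun h => ?_⟩, Real.arctan K⁻¹,
    Real.arctan_pos.2 (inv_pos.2 hK), (Real.arctan_lt_pi_div_two _).le, U, fun t _ => rfl,
    hUd.mono (sector_arctan_subset_interior hK), ?_, ?_⟩
  · obtain ⟨x, rfl, rfl⟩ := LinearPMap.mem_graph_iff _ |>.1 h
    exact hTA x
  · -- the generator of `T` is a dissipative extension of `A`, hence equal to `A`
    obtain ⟨w, hw⟩ := hs1 (x - y)
    have h1 : (⟪x - w, y - A w⟫_ℂ).re ≤ 0 := by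
      refine hT.re_inner_nonpos ((h.sub (hTA w)).congr fun t => ?_)
      rw [← smul_sub, map_sub]
      congr 1
      abel
    have h2 : y - A w = x - w := by
      rw [← sub_eq_zero] at hw ⊢
      rw [← hw]
      abel
    have h4 : (⟪x - w, x - w⟫_ℂ).re = ‖x - w‖ ^ 2 := inner_self_eq_norm_sq (𝕜 := ℂ) _
    rw [h2, h4] at h1
    have h5 : x - w = 0 := norm_eq_zero.1 (pow_eq_zero_iff two_ne_zero |>.1
      (le_antisymm h1 (sq_nonneg _)))
    rw [h5] at h2
    rw [sub_eq_zero.1 h5, sub_eq_zero.1 h2]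
    exact A.mem_graph w
  · have hsub := (sector_arctan_subset_interior hK).trans interior_subset
    exact fun z hz w hw => hUadd z (hsub hz) w (hsub hw)
  · intro θ' _ hθ' x
    have hsub : C0Semigroup.sector θ' ⊆ Z := fun z hz =>
      interior_subset (sector_arctan_subset_interior hK ⟨hz.1, hz.2.trans hθ'⟩)
    have h1 := (hUc x 0 hZ0).tendsto.mono_left (nhdsWithin_mono 0 hsub)
    simpa [hU0] using h1

/-! ### Rescaled semigroups -/

section Rescale

variable {X : Type*} [NormedAddCommGroup X]

/-- The rescaled semigroup `e^{ω t} T(t)`. -/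
noncomputable def C0Semigroup.rescale [NormedSpace ℂ X] (T : C0Semigroup X) (ω : ℝ) :
    C0Semigroup X where
  toFun t := Complex.exp (ω * (t : ℝ)) • T.toFun t
  map_zero := by simp [T.map_zero]
  map_add s t := by
    ext x
    simp [T.map_add, smul_smul, ← Complex.exp_add, mul_add, add_comm]
  continuous_orbit x := by
    have h : Continuous fun t : ℝ≥0 => Complex.exp (ω * (t : ℝ)) := by fun_prop
    exact h.smul (T.continuous_orbit x)

theorem C0Semigroup.HasGenerator.rescale [NormedSpace ℂ X] {T : C0Semigroup X} {A : X →ₗ.[ℂ] X}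
    {ω : ℝ} (h : T.HasGenerator ((-(ω : ℂ) • LinearMap.id : X →ₗ[ℂ] X) +ᵥ A)) :
    (T.rescale ω).HasGenerator A := by
  have hexp : Tendsto (fun t : ℝ≥0 => Complex.exp (ω * (t : ℝ))) (𝓝[>] 0) (𝓝 1) := by
    have h : Continuous fun t : ℝ≥0 => Complex.exp (ω * (t : ℝ)) := by fun_prop
    simpa using (h.tendsto 0).mono_left nhdsWithin_le_nhds
  have hder : Tendsto (fun t : ℝ≥0 => ((t : ℝ) : ℂ)⁻¹ * (Complex.exp (ω * (t : ℝ)) - 1))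
      (𝓝[>] 0) (𝓝 ω) := by
    have h1 : HasDerivAt (fun t : ℝ => Complex.exp (ω * t)) ω 0 := by
      simpa using ((hasDerivAt_id (0 : ℝ)).ofReal_comp.const_mul (ω : ℂ)).cexp
    refine (h1.tendsto_slope_zero_right.comp tendsto_coe_nhdsGT_zero).congr fun t => ?_
    simp
  have hgraph : ∀ x y : X, (x, y) ∈ A.graph ↔
      (x, y - (ω : ℂ) • x) ∈ ((-(ω : ℂ) • LinearMap.id : X →ₗ[ℂ] X) +ᵥ A).graph := by
    intro x y
    rw [LinearPMap.mem_graph_iff, LinearPMap.mem_graph_iff]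
    refine exists_congr fun u => and_congr_right fun hu => ?_
    rw [LinearPMap.vadd_apply]
    change A u = y ↔ -(ω : ℂ) • (u : X) + A u = y - (ω : ℂ) • x
    rw [hu, neg_smul, neg_add_eq_sub, sub_left_inj]
  intro x y
  rw [hgraph, h]
  constructor
  · intro h1
    have h2 := (hexp.smul h1).add (hder.smul_const x)
    rw [one_smul, sub_add_cancel] at h2
    refine h2.congr fun t => ?_
    change _ = _ • (Complex.exp (ω * (t : ℝ)) • T.toFun t x - x)
    module
  · intro h1
    have h2 := (hexp.inv₀ one_ne_zero).smul (h1.sub (hder.smul_const x))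
    rw [inv_one, one_smul] at h2
    refine h2.congr fun t => ?_
    have h3 : ((t : ℝ) : ℂ)⁻¹ • ((T.rescale ω).toFun t x - x)
        - (((t : ℝ) : ℂ)⁻¹ * (Complex.exp (ω * (t : ℝ)) - 1)) • x
        = Complex.exp (ω * (t : ℝ)) • ((t : ℝ) : ℂ)⁻¹ • (T.toFun t x - x) := by
      change _ • (Complex.exp (ω * (t : ℝ)) • T.toFun t x - x) - _ = _
      module
    rw [h3, inv_smul_smul₀ (Complex.exp_ne_zero _)]

theorem C0Semigroup.IsAnalytic.rescale [NormedSpace ℂ X] {T : C0Semigroup X} (h : T.IsAnalytic)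
    (ω : ℝ) : (T.rescale ω).IsAnalytic := by
  obtain ⟨θ, h0, hθ, U, h1, h2, h3, h4⟩ := h
  refine ⟨θ, h0, hθ, fun z => Complex.exp (ω * z) • U z, fun t ht => ?_, ?_, ?_, ?_⟩
  · simp only [h1 t ht]; rfl
  · have h : Differentiable ℂ fun z : ℂ => Complex.exp (ω * z) := by fun_prop
    exact h.differentiableOn.smul h2
  · intro z hz w hw
    ext x
    simp [h3 z hz w hw, smul_smul, ← Complex.exp_add, mul_add, add_comm]
  · intro θ' h5 h6 x
    have h : Continuous fun z : ℂ => Complex.exp (ω * z) := by fun_prop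
    have h7 := ((h.tendsto 0).mono_left (nhdsWithin_le_nhds (s := C0Semigroup.sector θ'))).smul
      (h4 θ' h5 h6 x)
    simpa using h7

/-- The version of `exists_analytic_semigroup_of_sectorial` for a sector with vertex `ω`. -/
theorem exists_analytic_semigroup_of_quasiSectorial [InnerProductSpace ℂ X] [CompleteSpace X]
    {A : X →ₗ.[ℂ] X} {K ω : ℝ} (hK : 0 < K)
    (hsec : ∀ x : A.domain,
      |(⟪(x : X), A x⟫_ℂ).im| ≤ K * (ω * ‖(x : X)‖ ^ 2 - (⟪(x : X), A x⟫_ℂ).re))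
    (hs : ∀ l : ℝ, ω < l → ∀ y : X, ∃ x : A.domain, (l : ℂ) • (x : X) - A x = y) :
    ∃ T : C0Semigroup X, T.HasGenerator A ∧ T.IsAnalytic := by
  have happ : ∀ x : A.domain, ((-(ω : ℂ) • LinearMap.id : X →ₗ[ℂ] X) +ᵥ A) x
      = -(ω : ℂ) • (x : X) + A x := fun _ => rfl
  obtain ⟨T, hT, hT'⟩ := exists_analytic_semigroup_of_sectorial hK
    (A := (-(ω : ℂ) • LinearMap.id : X →ₗ[ℂ] X) +ᵥ A) (fun (x : A.domain) => by
      have h1 : ⟪(x : X), ((-(ω : ℂ) • LinearMap.id : X →ₗ[ℂ] X) +ᵥ A) x⟫_ℂ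
          = ((-(ω * ‖(x : X)‖ ^ 2) : ℝ) : ℂ) + ⟪(x : X), A x⟫_ℂ := by
        rw [happ, inner_add_right, inner_smul_right, inner_self_eq_norm_sq_to_K]
        push_cast
        simp
      rw [h1, Complex.add_im, Complex.add_re, Complex.ofReal_im, Complex.ofReal_re, zero_add]
      refine (hsec x).trans (le_of_eq ?_)
      ring) (fun l hl y => by
      obtain ⟨x, hx⟩ := hs (l + ω) (by linarith) y
      refine ⟨x, Eq.trans ?_ hx⟩
      rw [happ]
      push_cast
      module)
  exact ⟨T.rescale ω, hT.rescale, hT'.rescale ω⟩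

end Rescale

/-! ### The structure of `A_ext` -/

section Operators

variable {H₁ H₂ : Type*} [NormedAddCommGroup H₁] [InnerProductSpace ℂ H₁]
  [NormedAddCommGroup H₂] [InnerProductSpace ℂ H₂]
  {A₁ : WithLp 2 (H₁ × H₂) →ₗ.[ℂ] H₁} {A₂₁ : H₁ →ₗ.[ℂ] H₂} {S : H₂ →L[ℂ] H₂}
  {A₁₁ : H₁ →L[ℂ] H₁} {A₁₂ : H₂ →ₗ.[ℂ] H₁}

theorem SplitsAs.mem_domain_iff (h : SplitsAs A₁ ((A₁₁ : H₁ →ₗ[ℂ] H₁).toPMap ⊤) A₁₂)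
    (x : WithLp 2 (H₁ × H₂)) : x ∈ A₁.domain ↔ x.snd ∈ A₁₂.domain :=
  (h.1 x).trans (and_iff_right Submodule.mem_top)

theorem SplitsAs.apply (h : SplitsAs A₁ ((A₁₁ : H₁ →ₗ[ℂ] H₁).toPMap ⊤) A₁₂) (u : H₁)
    (w : A₁₂.domain) (hx : WithLp.toLp 2 (u, (w : H₂)) ∈ A₁.domain) :
    A₁ ⟨WithLp.toLp 2 (u, (w : H₂)), hx⟩ = A₁₁ u + A₁₂ w :=
  h.2 _ ⟨u, Submodule.mem_top⟩ w rfl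

/-- The pair `(u, w)` as an element of `dom A_ext = dom A₂₁ × dom A₁₂`. -/
def SplitsAs.pair (h : SplitsAs A₁ ((A₁₁ : H₁ →ₗ[ℂ] H₁).toPMap ⊤) A₁₂) (u : A₂₁.domain)
    (w : A₁₂.domain) : (opExt A₁ A₂₁).domain :=
  ⟨WithLp.toLp 2 ((u : H₁), (w : H₂)), (h.mem_domain_iff _).2 w.2, u.2⟩

theorem SplitsAs.opExt_pair (h : SplitsAs A₁ ((A₁₁ : H₁ →ₗ[ℂ] H₁).toPMap ⊤) A₁₂)
    (u : A₂₁.domain) (w : A₁₂.domain) :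
    opExt A₁ A₂₁ (h.pair u w) = WithLp.toLp 2 (A₁₁ u + A₁₂ w, A₂₁ u) := by
  rw [← h.apply u w (h.pair u w).2.1]
  rfl

theorem SplitsAs.exists_eq_pair (h : SplitsAs A₁ ((A₁₁ : H₁ →ₗ[ℂ] H₁).toPMap ⊤) A₁₂)
    (x : (opExt A₁ A₂₁).domain) : ∃ u w, x = h.pair u w :=
  ⟨⟨_, x.2.2⟩, ⟨_, (h.mem_domain_iff _).1 x.2.1⟩, rfl⟩

theorem SplitsAs.re_inner_nonpos (h : SplitsAs A₁ ((A₁₁ : H₁ →ₗ[ℂ] H₁).toPMap ⊤) A₁₂)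
    (hd : IsDissipative (opExt A₁ A₂₁)) (u : A₂₁.domain) (w : A₁₂.domain) :
    (⟪(u : H₁), A₁₁ u⟫_ℂ + (⟪(u : H₁), A₁₂ w⟫_ℂ + ⟪(w : H₂), A₂₁ u⟫_ℂ)).re ≤ 0 := by
  have h1 := hd (h.pair u w)
  rw [h.opExt_pair, WithLp.prod_inner_apply] at h1
  rw [← add_assoc, ← inner_add_right]
  exact h1

/-- A dissipative `A_ext` forces `-A₁₂ ⊆ A₂₁*`: the linear terms
`Re (c ⟨A₁₂ w, u⟩ + c̄ ⟨A₂₁ u, w⟩)`, where `c` is any complex number, are bounded above. -/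
theorem SplitsAs.inner_eq_neg_inner (h : SplitsAs A₁ ((A₁₁ : H₁ →ₗ[ℂ] H₁).toPMap ⊤) A₁₂)
    (hd : IsDissipative (opExt A₁ A₂₁)) (u : A₂₁.domain) (w : A₁₂.domain) :
    ⟪A₂₁ u, (w : H₂)⟫_ℂ = -⟪(u : H₁), A₁₂ w⟫_ℂ := by
  set p := ⟪(u : H₁), A₁₂ w⟫_ℂ with hp
  set q := ⟪A₂₁ u, (w : H₂)⟫_ℂ with hq
  have hqc : ⟪(w : H₂), A₂₁ u⟫_ℂ = conj q := (inner_conj_symm _ _).symm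
  have hc : ∀ c : ℂ, (⟪(u : H₁), A₁₁ u⟫_ℂ).re + (c * (p + q)).re ≤ 0 := by
    intro c
    have h1 := h.re_inner_nonpos hd u (c • w)
    rw [LinearPMap.map_smul, Submodule.coe_smul, inner_smul_right, inner_smul_left, ← hp, hqc,
      ← map_mul, Complex.add_re, Complex.add_re, Complex.conj_re, ← Complex.add_re (c * p),
      ← mul_add] at h1
    exact h1
  by_contra hne
  have h0 : p + q ≠ 0 := fun h0 => hne (eq_neg_of_add_eq_zero_right h0)
  -- this `c` turns the left side of `hc c` into `1`
  have h1 := hc (((1 - (⟪(u : H₁), A₁₁ u⟫_ℂ).re : ℝ) : ℂ) * (p + q)⁻¹)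
  rw [mul_assoc, inv_mul_cancel₀ h0, mul_one, Complex.ofReal_re] at h1
  linarith

/-- Maximality of `A_ext` gives `A₂₁* ⊆ -A₁₂`. If `⟨v, f⟩ = ⟨A₂₁ v, h₂⟩` on `dom A₂₁`, solve
`(1 - A_ext) (u, w) = (f, h₂)`; testing with `u` shows that `u = 0`, so that `w = h₂`. -/
theorem SplitsAs.mem_graph_neg_of_inner_eq
    (h : SplitsAs A₁ ((A₁₁ : H₁ →ₗ[ℂ] H₁).toPMap ⊤) A₁₂)
    (hd : IsDissipative (opExt A₁ A₂₁))
    (hs : ∀ x, ∃ y : (opExt A₁ A₂₁).domain, (y : WithLp 2 (H₁ × H₂)) - opExt A₁ A₂₁ y = x)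
    {h₂ : H₂} {f : H₁} (hf : ∀ v : A₂₁.domain, ⟪A₂₁ v, h₂⟫_ℂ = ⟪(v : H₁), f⟫_ℂ) :
    ∃ w : A₁₂.domain, (w : H₂) = h₂ ∧ -A₁₂ w = f := by
  obtain ⟨y, hy⟩ := hs (WithLp.toLp 2 (f, h₂))
  obtain ⟨u, w, rfl⟩ := h.exists_eq_pair y
  rw [h.opExt_pair] at hy
  have e1 : (u : H₁) - (A₁₁ u + A₁₂ w) = f := congrArg WithLp.fst hy
  have e2 : (w : H₂) - A₂₁ u = h₂ := congrArg WithLp.snd hy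
  have h0 : (⟪(u : H₁), A₁₁ u⟫_ℂ).re ≤ 0 := by
    simpa using h.re_inner_nonpos hd u 0
  have h1 := congrArg Complex.re (hf u)
  have hn1 : (⟪(u : H₁), u⟫_ℂ).re = ‖(u : H₁)‖ ^ 2 := inner_self_eq_norm_sq (𝕜 := ℂ) _
  have hn2 : (⟪A₂₁ u, A₂₁ u⟫_ℂ).re = ‖A₂₁ u‖ ^ 2 := inner_self_eq_norm_sq (𝕜 := ℂ) _
  rw [← e1, ← e2, inner_sub_right, inner_sub_right, inner_add_right,
    h.inner_eq_neg_inner hd, Complex.sub_re, Complex.sub_re, Complex.add_re, Complex.neg_re,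
    hn1, hn2] at h1
  have h2 : u = 0 := by
    ext
    rw [ZeroMemClass.coe_zero, ← norm_eq_zero, ← sq_eq_zero_iff]
    refine le_antisymm ?_ (sq_nonneg _)
    linarith [sq_nonneg ‖A₂₁ u‖]
  subst h2
  refine ⟨w, by simpa using e2, by simpa using e1⟩

/-- The graph of `A₂₁` is the preimage of that of `A_ext` under
`(u, g) ↦ ((u, 0), (A₁₁ u, g))`. -/
theorem SplitsAs.isClosed_graph (h : SplitsAs A₁ ((A₁₁ : H₁ →ₗ[ℂ] H₁).toPMap ⊤) A₁₂)
    (hc : IsClosed ((opExt A₁ A₂₁).graph : Set (WithLp 2 (H₁ × H₂) × WithLp 2 (H₁ × H₂)))) :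
    IsClosed (A₂₁.graph : Set (H₁ × H₂)) := by
  have hg : Continuous fun p : H₁ × H₂ =>
      (WithLp.toLp 2 (p.1, (0 : H₂)), WithLp.toLp 2 (A₁₁ p.1, p.2)) := by fun_prop
  convert hc.preimage hg
  ext ⟨x, y⟩
  simp only [SetLike.mem_coe, Set.mem_preimage, LinearPMap.mem_graph_iff]
  constructor
  · rintro ⟨u, rfl, rfl⟩
    exact ⟨h.pair u 0, rfl, by simp [h.opExt_pair]⟩
  · rintro ⟨q, hq1, hq2⟩
    obtain ⟨u, w, rfl⟩ := h.exists_eq_pair q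
    rw [h.opExt_pair] at hq2
    exact ⟨u, congrArg WithLp.fst hq1, congrArg WithLp.snd hq2⟩

theorem dense_domain_of_opExt
    (hd : Dense ((opExt A₁ A₂₁).domain : Set (WithLp 2 (H₁ × H₂)))) :
    Dense (A₂₁.domain : Set H₁) := by
  have hf : Continuous (WithLp.fst : WithLp 2 (H₁ × H₂) → H₁) := by fun_prop
  have hsurj : Function.Surjective (WithLp.fst : WithLp 2 (H₁ × H₂) → H₁) := fun x =>
    ⟨WithLp.toLp 2 (x, 0), rfl⟩
  refine (hsurj.denseRange.dense_image hf hd).mono ?_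
  rintro _ ⟨x, hx, rfl⟩
  exact hx.2

theorem SplitsAs.mem_graph_opS_iff (h : SplitsAs A₁ ((A₁₁ : H₁ →ₗ[ℂ] H₁).toPMap ⊤) A₁₂)
    (x f : H₁) : (x, f) ∈ (opS A₁ A₂₁ S).graph ↔
      ∃ (u : A₂₁.domain) (w : A₁₂.domain), (u : H₁) = x ∧ (w : H₂) = S (A₂₁ u) ∧
        A₁₁ u + A₁₂ w = f := by
  rw [LinearPMap.mem_graph_iff]
  constructor
  · rintro ⟨y, rfl, rfl⟩
    refine ⟨⟨y, y.2.1⟩, ⟨S (A₂₁ ⟨y, y.2.1⟩), (h.mem_domain_iff _).1 y.2.2⟩, rfl, rfl, ?_⟩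
    exact (h.apply _ ⟨S (A₂₁ ⟨y, y.2.1⟩), (h.mem_domain_iff _).1 y.2.2⟩ y.2.2).symm
  · rintro ⟨u, w, rfl, hw, rfl⟩
    have hm : WithLp.toLp 2 ((u : H₁), S (A₂₁ u)) ∈ A₁.domain := by
      rw [← hw]; exact (h.mem_domain_iff _).2 w.2
    refine ⟨⟨u, u.2, hm⟩, rfl, ?_⟩
    have hw' : w = ⟨S (A₂₁ u), (h.mem_domain_iff _).1 hm⟩ := Subtype.ext hw
    rw [hw']
    exact h.apply u ⟨S (A₂₁ u), (h.mem_domain_iff _).1 hm⟩ hm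

end Operators

/-! ### The domain of a closed operator as a Hilbert space -/

namespace GraphDomain

variable {H K : Type*} [NormedAddCommGroup H] [InnerProductSpace ℂ H]
  [NormedAddCommGroup K] [InnerProductSpace ℂ K] (A : H →ₗ.[ℂ] K)

theorem norm_op_le (u : GraphDomain A) : ‖op A u‖ ≤ ‖u‖ := by
  refine le_of_sq_le_sq ?_ (norm_nonneg u)
  rw [norm_sq]
  linarith [sq_nonneg ‖incl A u‖]

theorem norm_incl_le (u : GraphDomain A) : ‖incl A u‖ ≤ ‖u‖ := by
  refine le_of_sq_le_sq ?_ (norm_nonneg u)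
  rw [norm_sq]
  linarith [sq_nonneg ‖op A u‖]

/-- The operator `A`, which is bounded for the graph norm. -/
noncomputable def opL : GraphDomain A →L[ℂ] K :=
  (op A).mkContinuous 1 fun u => by simpa using norm_op_le A u

/-- The inclusion of `dom A`, which is bounded for the graph norm. -/
noncomputable def inclL : GraphDomain A →L[ℂ] H :=
  (incl A).mkContinuous 1 fun u => by simpa using norm_incl_le A u

theorem completeSpace [CompleteSpace H] [CompleteSpace K]
    (hA : IsClosed (A.graph : Set (H × K))) : CompleteSpace (GraphDomain A) := by
  refine Metric.complete_of_cauchySeq_tendsto fun u hu => ?_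
  obtain ⟨x, hx⟩ := cauchySeq_tendsto_of_complete ((inclL A).uniformContinuous.comp_cauchySeq hu)
  obtain ⟨y, hy⟩ := cauchySeq_tendsto_of_complete ((opL A).uniformContinuous.comp_cauchySeq hu)
  have hxy : (x, y) ∈ A.graph := hA.mem_of_tendsto (hx.prodMk_nhds hy)
    (Eventually.of_forall fun n => A.mem_graph (u n))
  obtain ⟨v, rfl, rfl⟩ : ∃ v : GraphDomain A, incl A v = x ∧ op A v = y :=
    LinearPMap.mem_graph_iff _ |>.1 hxy
  refine ⟨v, tendsto_iff_norm_sub_tendsto_zero.2 ?_⟩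
  have h1 := ((tendsto_iff_norm_sub_tendsto_zero.1 hy).pow 2).add
    ((tendsto_iff_norm_sub_tendsto_zero.1 hx).pow 2)
  have h2 := h1.sqrt
  simp only [ne_eq, OfNat.ofNat_ne_zero, not_false_eq_true, zero_pow, add_zero,
    Real.sqrt_zero] at h2
  refine h2.congr fun n => ?_
  rw [Real.sqrt_eq_iff_mul_self_eq (by positivity) (norm_nonneg _), ← sq, norm_sq, map_sub, map_sub]
  rfl

end GraphDomain

/-! ### Operators associated to closed forms -/

section ClosedForms

variable {H V : Type*} [NormedAddCommGroup H] [InnerProductSpace ℂ H]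
  [NormedAddCommGroup V] [InnerProductSpace ℂ V] {ι : V →ₗ[ℂ] H} {a : V →ₗ[ℂ] V →ₗ⋆[ℂ] ℂ}

/-- The Lax–Milgram lemma for the form `a(u, v) + l ⟨u, v⟩` and functionals `v ↦ ⟨f, v⟩`, for `l`
at least the constant `ω` of the ellipticity estimate. -/
theorem exists_form_add_inner_eq [CompleteSpace H] [CompleteSpace V] (hι : Continuous ι) {M α l : ℝ}
    (hM : ∀ u v, ‖a u v‖ ≤ M * ‖u‖ * ‖v‖) (hα : 0 < α)
    (hell : ∀ u, α * ‖u‖ ^ 2 ≤ (a u u).re + l * ‖ι u‖ ^ 2) (f : H) :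
    ∃ u : V, ∀ v : V, a u v + l * ⟪ι v, ι u⟫_ℂ = ⟪ι v, f⟫_ℂ := by
  let B : V →L⋆[ℂ] V →L[ℂ] ℂ := a.flip.mkContinuous₂ M fun v u => by
    rw [LinearMap.flip_apply]
    exact (hM u v).trans (le_of_eq (by ring))
  let J : V →L[ℂ] H := ⟨ι, hι⟩
  let G : V →L[ℂ] V := ContinuousLinearMap.adjoint (InnerProductSpace.continuousLinearMapOfBilin B)
    + (l : ℂ) • (ContinuousLinearMap.adjoint J).comp J
  have hG : ∀ u v : V, ⟪v, G u⟫_ℂ = a u v + l * ⟪ι v, ι u⟫_ℂ := by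
    intro u v
    change ⟪v, ContinuousLinearMap.adjoint (InnerProductSpace.continuousLinearMapOfBilin B) u
      + (l : ℂ) • (ContinuousLinearMap.adjoint J) (J u)⟫_ℂ = _
    rw [inner_add_right, inner_smul_right, ContinuousLinearMap.adjoint_inner_right,
      ContinuousLinearMap.adjoint_inner_right, InnerProductSpace.continuousLinearMapOfBilin_apply]
    rfl
  have hunit : IsUnit G := by
    refine ContinuousLinearMap.isUnit_of_forall_le_norm_inner_map G (c := ⟨α, hα.le⟩) hα fun u => ?_
    rw [← inner_conj_symm, RCLike.norm_conj, hG]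
    refine le_trans ?_ (Complex.re_le_norm _)
    have h1 : (⟪ι u, ι u⟫_ℂ).re = ‖ι u‖ ^ 2 := inner_self_eq_norm_sq (𝕜 := ℂ) _
    rw [Complex.add_re, Complex.re_ofReal_mul, h1, mul_comm]
    exact hell u
  obtain ⟨g, hg⟩ := hunit
  refine ⟨(↑g⁻¹ : V →L[ℂ] V) (ContinuousLinearMap.adjoint J f), fun v => ?_⟩
  rw [← hG, ← hg, ← mul_apply_eq_comp, Units.mul_inv, one_apply_eq_self,
    ContinuousLinearMap.adjoint_inner_right]
  rfl

/-- If `-A` is the operator associated to a closed form, then `A` generates an analytic semigroup: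
boundedness and ellipticity of the form place the numerical range of `A` in a sector, and the
Lax–Milgram lemma shows that `l - A` is surjective for large `l`. -/
theorem IsClosedForm.exists_analytic_semigroup [CompleteSpace H] (h : IsClosedForm ι a)
    {A : H →ₗ.[ℂ] H} (hA : IsAssociatedOperator ι a (-A)) :
    ∃ T : C0Semigroup H, T.HasGenerator A ∧ T.IsAnalytic := by
  obtain ⟨M, hM0, hM⟩ := h.bounded
  obtain ⟨α, hα, ω, hell⟩ := h.elliptic
  have := h.complete
  refine exists_analytic_semigroup_of_quasiSectorial (K := (M + 1) / α) (ω := ω) (by positivity)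
    (fun x => ?_) fun l hl y => ?_
  · obtain ⟨u, hu, hau⟩ := (hA x (-A x)).1 ((-A).mem_graph x)
    have h1 : ⟪(x : H), A x⟫_ℂ = -a u u := by
      rw [hau, hu, inner_neg_right, neg_neg]
    rw [h1, Complex.neg_im, Complex.neg_re, abs_neg, ← hu, div_mul_eq_mul_div, le_div_iff₀ hα]
    have h2 : |(a u u).im| ≤ M * ‖u‖ * ‖u‖ := (Complex.abs_im_le_norm _).trans (hM u u)
    have h3 := mul_le_mul_of_nonneg_left (hell u) (by positivity : 0 ≤ M + 1)
    have h4 := mul_le_mul_of_nonneg_right h2 hα.le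
    have h5 : 0 ≤ α * ‖u‖ ^ 2 := by positivity
    nlinarith
  · obtain ⟨u, hu⟩ := exists_form_add_inner_eq h.continuous_incl hM hα
      (l := l) (fun u => (hell u).trans (by gcongr)) y
    have h1 : (ι u, y - (l : ℂ) • ι u) ∈ (-A).graph := (hA _ _).2 ⟨u, rfl, fun v => by
      rw [inner_sub_right, inner_smul_right, ← hu v, add_sub_cancel_right]⟩
    obtain ⟨x, hx1, hx2⟩ := LinearPMap.mem_graph_iff _ |>.1 h1
    refine ⟨x, ?_⟩
    have h2 : -A x = y - (l : ℂ) • ι u := hx2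
    rw [hx1, sub_eq_add_neg, h2, add_sub_cancel]

end ClosedForms

/-! ### The form of `A₂₁` and its operator -/

section FormOf

variable {H₁ H₂ : Type*} [NormedAddCommGroup H₁] [InnerProductSpace ℂ H₁]
  [NormedAddCommGroup H₂] [InnerProductSpace ℂ H₂]

theorem isClosedForm_formOf [CompleteSpace H₁] [CompleteSpace H₂] (A₁₁ : H₁ →L[ℂ] H₁)
    {A₂₁ : H₁ →ₗ.[ℂ] H₂} (hc : IsClosed (A₂₁.graph : Set (H₁ × H₂)))
    (hd : Dense (A₂₁.domain : Set H₁)) {S : H₂ →L[ℂ] H₂} (hS : IsCoerciveOperator S) :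
    IsClosedForm (GraphDomain.incl A₂₁) (formOf A₁₁ A₂₁ S) where
  complete := GraphDomain.completeSpace A₂₁ hc
  injective := Subtype.val_injective
  dense := hd.denseRange_val
  continuous_incl := (GraphDomain.inclL A₂₁).continuous
  bounded := by
    refine ⟨‖S‖ + ‖A₁₁‖, by positivity, fun u v => ?_⟩
    change ‖⟪GraphDomain.op A₂₁ v, S (GraphDomain.op A₂₁ u)⟫_ℂ
      - ⟪GraphDomain.incl A₂₁ v, A₁₁ (GraphDomain.incl A₂₁ u)⟫_ℂ‖ ≤ _
    refine (norm_sub_le _ _).trans ?_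
    have h1 : ‖⟪GraphDomain.op A₂₁ v, S (GraphDomain.op A₂₁ u)⟫_ℂ‖ ≤ ‖v‖ * (‖S‖ * ‖u‖) :=
      (norm_inner_le_norm _ _).trans (mul_le_mul (GraphDomain.norm_op_le A₂₁ v)
        (S.le_opNorm_of_le (GraphDomain.norm_op_le A₂₁ u)) (norm_nonneg _) (norm_nonneg _))
    have h2 : ‖⟪GraphDomain.incl A₂₁ v, A₁₁ (GraphDomain.incl A₂₁ u)⟫_ℂ‖
        ≤ ‖v‖ * (‖A₁₁‖ * ‖u‖) :=
      (norm_inner_le_norm _ _).trans (mul_le_mul (GraphDomain.norm_incl_le A₂₁ v)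
        (A₁₁.le_opNorm_of_le (GraphDomain.norm_incl_le A₂₁ u)) (norm_nonneg _) (norm_nonneg _))
    linarith
  elliptic := by
    obtain ⟨ν, hν, hS⟩ := hS
    refine ⟨ν, hν, ‖A₁₁‖ + ν, fun u => ?_⟩
    change _ ≤ (⟪GraphDomain.op A₂₁ u, S (GraphDomain.op A₂₁ u)⟫_ℂ
      - ⟪GraphDomain.incl A₂₁ u, A₁₁ (GraphDomain.incl A₂₁ u)⟫_ℂ).re + _
    rw [GraphDomain.norm_sq, Complex.sub_re]
    have h1 := hS (GraphDomain.op A₂₁ u)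
    have h2 : (⟪GraphDomain.incl A₂₁ u, A₁₁ (GraphDomain.incl A₂₁ u)⟫_ℂ).re
        ≤ ‖GraphDomain.incl A₂₁ u‖ * (‖A₁₁‖ * ‖GraphDomain.incl A₂₁ u‖) :=
      (re_inner_le_norm (𝕜 := ℂ) _ _).trans
        (mul_le_mul_of_nonneg_left (A₁₁.le_opNorm _) (norm_nonneg _))
    nlinarith

variable {A₁ : WithLp 2 (H₁ × H₂) →ₗ.[ℂ] H₁} {A₂₁ : H₁ →ₗ.[ℂ] H₂}
  {A₁₁ : H₁ →L[ℂ] H₁} {A₁₂ : H₂ →ₗ.[ℂ] H₁}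

/-- As `-A₁₂ = A₂₁*`, the identity `⟨S A₂₁ u, A₂₁ v⟩ = ⟨f + A₁₁ u, v⟩` for all `v` means that
`S A₂₁ u ∈ dom A₁₂` and `-A₁₂ S A₂₁ u = f + A₁₁ u`. -/
theorem SplitsAs.isAssociatedOperator (h : SplitsAs A₁ ((A₁₁ : H₁ →ₗ[ℂ] H₁).toPMap ⊤) A₁₂)
    (hd : IsDissipative (opExt A₁ A₂₁))
    (hs : ∀ x, ∃ y : (opExt A₁ A₂₁).domain, (y : WithLp 2 (H₁ × H₂)) - opExt A₁ A₂₁ y = x)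
    (S : H₂ →L[ℂ] H₂) :
    IsAssociatedOperator (GraphDomain.incl A₂₁) (formOf A₁₁ A₂₁ S) (-opS A₁ A₂₁ S) := by
  intro x f
  have hneg : (x, f) ∈ (-opS A₁ A₂₁ S).graph ↔ (x, -f) ∈ (opS A₁ A₂₁ S).graph := by
    rw [LinearPMap.mem_graph_iff, LinearPMap.mem_graph_iff]
    exact exists_congr fun y => and_congr_right fun _ => neg_eq_iff_eq_neg
  rw [hneg, h.mem_graph_opS_iff]
  constructor
  · rintro ⟨u, w, rfl, hw, hf⟩
    refine ⟨u, rfl, fun (v : A₂₁.domain) => ?_⟩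
    change ⟪A₂₁ v, S (A₂₁ u)⟫_ℂ - ⟪(v : H₁), A₁₁ u⟫_ℂ = ⟪(v : H₁), f⟫_ℂ
    rw [← hw, h.inner_eq_neg_inner hd, ← neg_eq_iff_eq_neg.2 hf, inner_neg_right,
      inner_add_right]
    ring
  · rintro ⟨(u : A₂₁.domain), rfl, hu⟩
    obtain ⟨w, hw1, hw2⟩ := h.mem_graph_neg_of_inner_eq hd hs (h₂ := S (A₂₁ u)) (f := f + A₁₁ u)
      fun v => by
        rw [inner_add_right, ← sub_eq_iff_eq_add]
        exact hu v
    refine ⟨u, w, rfl, hw1, ?_⟩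
    rw [neg_eq_iff_eq_neg.1 hw2]
    abel

end FormOf

theorem mainTheorem5 {H₁ H₂ : Type*}
    [NormedAddCommGroup H₁] [InnerProductSpace ℂ H₁] [CompleteSpace H₁]
    [NormedAddCommGroup H₂] [InnerProductSpace ℂ H₂] [CompleteSpace H₂]
    (A₁ : WithLp 2 (H₁ × H₂) →ₗ.[ℂ] H₁) (A₂₁ : H₁ →ₗ.[ℂ] H₂)
    (S : H₂ →L[ℂ] H₂) (hS : IsCoerciveOperator S)
    (A₁₁ : H₁ →L[ℂ] H₁) (A₁₂ : H₂ →ₗ.[ℂ] H₁)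
    (hsplit : SplitsAs A₁ ((A₁₁ : H₁ →ₗ[ℂ] H₁).toPMap ⊤) A₁₂)
    (hext : GeneratesContractionSemigroup (opExt A₁ A₂₁)) :
    IsClosedForm (GraphDomain.incl A₂₁) (formOf A₁₁ A₂₁ S) ∧
    IsAssociatedOperator (GraphDomain.incl A₂₁) (formOf A₁₁ A₂₁ S) (-opS A₁ A₂₁ S) ∧
    ∃ T : C0Semigroup H₁, T.HasGenerator (opS A₁ A₂₁ S) ∧ T.IsAnalytic := by
  obtain ⟨T, hT, hTc⟩ := hext
  have hd := hT.isDissipative hTc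
  have hs := hT.exists_sub_eq hTc
  have hform := isClosedForm_formOf A₁₁ (hsplit.isClosed_graph (hd.isClosed_graph hs))
    (dense_domain_of_opExt (hd.dense_domain hs)) hS
  have hop := hsplit.isAssociatedOperator hd hs S
  exact ⟨hform, hop, hform.exists_analytic_semigroup hop⟩
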